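/- Let $n\ge 1$, let $A\in\mathbb C^{n\times n}$ have all its eigenvalues in the open unit disk, let $B\in\mathbb C^{n\times 1}$ be nonzero with $(A,B)$ reachable (the vectors $B,AB,A^2B,\dots$ span $\mathbb C^n$), and put $G(z)=(zI-A)^{-1}B$ for $z$ on the unit circle $\mathbb T$; $G^*$ is the conjugate transpose of $G$ on $\mathbb T$, and all integrals are over $\mathbb T$ with respect to $d\vartheta/2\pi$. Let $\operatorname{Range}\Gamma$ be the set of the matrices $\int G\Phi G^*$ with $\Phi:\mathbb T\to\mathbb R$ continuous, and let $P_\Gamma=\{\Sigma\in\operatorname{Range}\Gamma:\Sigma>0\}$, with the topology induced by the Frobenius norm. Let $\mathcal S_+$ be the set of (classes of) measurable $\Phi:\mathbb T\to\mathbb R$ with $c\le\Phi\le C$ a.e. for some constants $0<c\le C$, and let $\Psi\in\mathcal S_+$. Let $\mathcal L_\Gamma^{KL}$ be the set of Hermitian $\Lambda\in\operatorname{Range}\Gamma$ with $G^*\Lambda G>0$ everywhere on $\mathbb T$. Then: 1. For every $\Sigma\in P_\Gamma$ the functional $J(\Lambda;\Sigma)=-\int\Psi\log(G^*\Lambda G)+\operatorname{tr}(\Lambda\Sigma)$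 has a unique minimum point $\Lambda^{KL}_{\rm opt}(\Sigma)$ in $\mathcal L_\Gamma^{KL}$. 2. For every $\Sigma\in P_\Gamma$ the function $$\Phi^{KL}_{\rm opt}(\Sigma)=\frac{\Psi}{G^*\Lambda^{KL}_{\rm opt}(\Sigma)G}$$ is the unique (up to a.e. equality) minimizer of the Kullback–Leibler pseudo-distance $\mathbb D(\Psi\|\Phi)=\int\Psi\log(\Psi/\Phi)$ over all $\Phi\in\mathcal S_+$ with $\int G\Phi G^*=\Sigma$. 3. For every $\Sigma\in P_\Gamma$, $\Phi^{KL}_{\rm opt}(\Sigma)\in L_\infty(\mathbb T)$, and the map $\Sigma\mapsto\Phi^{KL}_{\rm opt}(\Sigma)$ is continuous from $P_\Gamma$ to $L_\infty(\mathbb T)$. -/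

import Mathlib

open MeasureTheory Matrix
open scoped ENNReal ComplexOrder

noncomputable section

namespace SpectrumApprox

instance : MeasurableSpace Circle := borel Circle

instance : BorelSpace Circle := ⟨rfl⟩

/-- Normalized Lebesgue measure `dϑ / 2π` on the unit circle. -/
def circleMeasure : Measure Circle :=
  ENNReal.ofReal (2 * Real.pi)⁻¹ •
    (volume.restrict (Set.Ioc (-Real.pi) Real.pi)).map (fun t : ℝ => Circle.exp t)

variable {n : ℕ}

/-- `A` is a (discrete-time) stability matrix: all its eigenvalues lie in the open unit disk. -/
def IsStabilityMatrix (A : Matrix (Fin n) (Fin n) ℂ) : Prop :=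
  ∀ l ∈ spectrum ℂ A, ‖l‖ < 1

/-- `(A, b)` is reachable: the vectors `b, A b, A² b, …` span the state space. -/
def IsReachable (A : Matrix (Fin n) (Fin n) ℂ) (b : Fin n → ℂ) : Prop :=
  Submodule.span ℂ (Set.range fun k : ℕ => (A ^ k) *ᵥ b) = ⊤

/-- The transfer function `G(z) = (zI - A)⁻¹ b`, restricted to the unit circle. -/
def G (A : Matrix (Fin n) (Fin n) ℂ) (b : Fin n → ℂ) (z : Circle) : Fin n → ℂ :=
  ((z : ℂ) • (1 : Matrix (Fin n) (Fin n) ℂ) - A)⁻¹ *ᵥ b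

/-- The (real) value of `G* L G` at a point of the unit circle, for Hermitian `L`. -/
def quadForm (A : Matrix (Fin n) (Fin n) ℂ) (b : Fin n → ℂ)
    (L : Matrix (Fin n) (Fin n) ℂ) (z : Circle) : ℝ :=
  (star (G A b z) ⬝ᵥ (L *ᵥ G A b z)).re

/-- The matrix `∫ G Φ G*`, integrated entrywise. -/
def stateCov (A : Matrix (Fin n) (Fin n) ℂ) (b : Fin n → ℂ) (Φ : Circle → ℝ) :
    Matrix (Fin n) (Fin n) ℂ :=
  Matrix.of fun i j => ∫ z, G A b z i * (Φ z : ℂ) * star (G A b z j) ∂circleMeasure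

/-- The range of the operator `Φ ↦ ∫ G Φ G*` on the continuous real functions on the circle. -/
def rangeGamma (A : Matrix (Fin n) (Fin n) ℂ) (b : Fin n → ℂ) :
    Set (Matrix (Fin n) (Fin n) ℂ) :=
  Set.range fun Φ : C(Circle, ℝ) => stateCov A b Φ

/-- The positive definite matrices in the range of that operator. -/
def PGamma (A : Matrix (Fin n) (Fin n) ℂ) (b : Fin n → ℂ) :
    Set (Matrix (Fin n) (Fin n) ℂ) :=
  {S | S ∈ rangeGamma A b ∧ S.PosDef}

/-- Scalar, bounded and coercive spectral densities on the unit circle. -/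
def IsSpectralDensity (Φ : Circle → ℝ) : Prop :=
  AEStronglyMeasurable Φ circleMeasure ∧
    ∃ c C : ℝ, 0 < c ∧ ∀ᵐ z ∂circleMeasure, c ≤ Φ z ∧ Φ z ≤ C

/-- The Kullback-Leibler pseudo-distance `∫ Ψ log (Ψ / Φ)`. -/
def klDist (Ψ Φ : Circle → ℝ) : ℝ :=
  ∫ z, Ψ z * Real.log (Ψ z / Φ z) ∂circleMeasure

/-- `Φ` minimizes the Kullback-Leibler pseudo-distance from `Ψ` among the spectral densities
with `∫ G Φ G* = S`. -/
def IsPrimalSolution (A : Matrix (Fin n) (Fin n) ℂ) (b : Fin n → ℂ) (Ψ : Circle → ℝ)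
    (S : Matrix (Fin n) (Fin n) ℂ) (Φ : Circle → ℝ) : Prop :=
  IsSpectralDensity Φ ∧ stateCov A b Φ = S ∧
    ∀ Φ' : Circle → ℝ, IsSpectralDensity Φ' → stateCov A b Φ' = S → klDist Ψ Φ ≤ klDist Ψ Φ'

/-- The domain of the dual problem: the Hermitian matrices `L` in the range of `Γ` with
`G* L G > 0` on the whole unit circle. -/
def dualDomain (A : Matrix (Fin n) (Fin n) ℂ) (b : Fin n → ℂ) :
    Set (Matrix (Fin n) (Fin n) ℂ) :=
  {L | L.IsHermitian ∧ (∀ z : Circle, 0 < quadForm A b L z) ∧ L ∈ rangeGamma A b}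

/-- The dual functional `J(L; S) = - ∫ Ψ log (G* L G) + tr (L S)`. -/
def dualFunctional (A : Matrix (Fin n) (Fin n) ℂ) (b : Fin n → ℂ) (Ψ : Circle → ℝ)
    (S L : Matrix (Fin n) (Fin n) ℂ) : ℝ :=
  -(∫ z, Ψ z * Real.log (quadForm A b L z) ∂circleMeasure) + (L * S).trace.re

/-- `L` is a minimum point of the dual functional over the dual domain. -/
def IsDualSolution (A : Matrix (Fin n) (Fin n) ℂ) (b : Fin n → ℂ) (Ψ : Circle → ℝ)
    (S L : Matrix (Fin n) (Fin n) ℂ) : Prop :=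
  L ∈ dualDomain A b ∧ IsMinOn (dualFunctional A b Ψ S) (dualDomain A b) L

/-- The minimum point of the dual functional (an arbitrary matrix if there is none). -/
def dualOpt (A : Matrix (Fin n) (Fin n) ℂ) (b : Fin n → ℂ) (Ψ : Circle → ℝ)
    (S : Matrix (Fin n) (Fin n) ℂ) : Matrix (Fin n) (Fin n) ℂ :=
  Classical.epsilon (IsDualSolution A b Ψ S)

/-- The optimal spectrum `Ψ / (G* L G)`, with `L` the minimum point of the dual functional. -/
def optSpectrum (A : Matrix (Fin n) (Fin n) ℂ) (b : Fin n → ℂ) (Ψ : Circle → ℝ)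
    (S : Matrix (Fin n) (Fin n) ℂ) (z : Circle) : ℝ :=
  Ψ z / quadForm A b (dualOpt A b Ψ S) z

end SpectrumApprox

end

/-! On the finite-dimensional real space `rangeSub`, the map `L ↦ G* L G` is linear and injective
into the continuous functions: if it kills `L = ∫ G Φ G*`, then `tr (L L) = ∫ Φ (G* L G) = 0`. The
dual problem is thus to minimize `-∫ Ψ log (q L) + σ L` over the cone `q L > 0`, with `σ = tr (·
S)`. The abstract analysis needs two facts.

Coercivity, `δ ‖L‖ ≤ σ L` on the cone (`tracePairing_coercive`). The function `Φ` representing `S`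
may change sign, so `tr (L S) ≥ 0` is not evident. It follows from writing `S` as a finite sum of
terms `|β|² G(z) G(z)*` (`exists_sum_vecMulVec`): for the inner product given by `S`, `Aᴴ` is
isometric on the orthogonal complement of `b`, extends to a unitary map, and the eigenvectors of
that map yield the points `z`. Applying this to `S - ε ∫ G G*` gives the strict bound.

Divergence, `∫ 1 / (q L) → ∞` as `min q L → 0` on bounded sets (`rangeQuad_integral_inv_diverges`).
The functions `q L` are uniformly Lipschitz on a one-dimensional circle, so the integral grows at
least like `log (1/ε)`. The functional may stay finite at the boundary of the cone, but its slope
there repels minimizers (`exists_isMinOn_logBarrier`).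

A minimizer is stationary: `∫ Ψ q h / q L = σ h` for every `h`. Comparing two stationary points
(`IsStationary.sq_norm_sub_le`) yields uniqueness when the functionals `σ` agree, and continuity of
the minimizer in `S` otherwise. Stationarity also says that `Ψ / (G* L G)` has state covariance `S`;
its optimality then comes from `log u ≤ u - 1` (`klDist_le_imp_ae_eq`). -/

noncomputable section

namespace SpectrumApprox

/-! ### Normalized measure on the circle and a logarithmically divergent integral. -/

section

theorem measurable_circleExp : Measurable (fun t : ℝ => Circle.exp t) :=
  Circle.exp.continuous.measurable

instance : IsProbabilityMeasure circleMeasure := by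
  constructor
  rw [circleMeasure, Measure.smul_apply, Measure.map_apply measurable_circleExp MeasurableSet.univ]
  simp only [Set.preimage_univ, Measure.restrict_apply_univ, Real.volume_Ioc, smul_eq_mul]
  rw [← ENNReal.ofReal_mul (by positivity), sub_neg_eq_add, ← two_mul,
    inv_mul_cancel₀ (by positivity), ENNReal.ofReal_one]

theorem integral_circleMeasure {f : Circle → ℝ} (hf : Continuous f) :
    ∫ z, f z ∂circleMeasure = (2 * Real.pi)⁻¹ * ∫ t in -Real.pi..Real.pi, f (Circle.exp t) := by
  rw [circleMeasure, integral_smul_measure,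
    integral_map measurable_circleExp.aemeasurable hf.aestronglyMeasurable,
    intervalIntegral.integral_of_le (by linarith [Real.pi_pos]),
    ENNReal.toReal_ofReal (by positivity), smul_eq_mul]

instance : circleMeasure.IsOpenPosMeasure := by
  constructor
  rintro U hU ⟨z, hz⟩
  rw [circleMeasure, Measure.smul_apply, Measure.map_apply measurable_circleExp hU.measurableSet,
    Measure.restrict_apply (measurable_circleExp hU.measurableSet), smul_eq_mul]
  refine mul_ne_zero (by simpa using Real.pi_pos) ?_
  have hV : IsOpen ((fun t : ℝ => Circle.exp t) ⁻¹' U) := hU.preimage Circle.exp.continuous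
  have hmem : Complex.arg (z : ℂ) ∈ ((fun t : ℝ => Circle.exp t) ⁻¹' U) := by
    simpa [Circle.exp_arg] using hz
  -- The argument may be the endpoint `π`; as a limit of interior points it still forces the open
  -- preimage to meet the open interval.
  have hcl : Complex.arg (z : ℂ) ∈ closure (Set.Ioo (-Real.pi) Real.pi) := by
    rw [closure_Ioo (by linarith [Real.pi_pos])]
    exact ⟨(Complex.neg_pi_lt_arg _).le, Complex.arg_le_pi _⟩
  have hne : (((fun t : ℝ => Circle.exp t) ⁻¹' U) ∩ Set.Ioo (-Real.pi) Real.pi).Nonempty :=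
    mem_closure_iff.1 hcl _ hV hmem
  have := (hV.inter isOpen_Ioo).measure_pos volume hne
  exact (this.trans_le (measure_mono
    (Set.inter_subset_inter_right _ Set.Ioo_subset_Ioc_self))).ne'

theorem dist_circleExp_le (s t : ℝ) : dist (Circle.exp s) (Circle.exp t) ≤ |s - t| := by
  have : dist (Circle.exp s) (Circle.exp t) = ‖Complex.exp (Complex.I * (s - t : ℝ)) - 1‖ := by
    change dist (Circle.exp s : ℂ) (Circle.exp t : ℂ) = _
    rw [dist_eq_norm, Circle.coe_exp, Circle.coe_exp]
    have h : Complex.exp (s * Complex.I) - Complex.exp (t * Complex.I)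
        = Complex.exp (t * Complex.I) * (Complex.exp (Complex.I * (s - t : ℝ)) - 1) := by
      rw [mul_sub, ← Complex.exp_add]; push_cast; ring_nf
    rw [h, norm_mul, Complex.norm_exp_ofReal_mul_I, one_mul]
  rw [this]
  exact Real.norm_exp_I_mul_ofReal_sub_one_le

theorem integral_inv_add_mul {K ε : ℝ} (hK : 0 < K) (hε : 0 < ε) :
    ∫ s in (0 : ℝ)..Real.pi, (ε + K * s)⁻¹ = K⁻¹ * Real.log ((ε + K * Real.pi) / ε) := by
  rw [intervalIntegral.integral_comp_add_mul (fun x => x⁻¹) hK.ne', mul_zero, add_zero,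
    integral_inv_of_pos hε (by positivity), smul_eq_mul]

/-- The integrals of `1 / (ε + K |z - z₀|)` diverge as `ε → 0`, uniformly in `z₀`. -/
theorem exists_le_integral_inv {K : ℝ} (hK : 0 < K) (M : ℝ) :
    ∃ ε₀ > 0, ∀ ε, 0 < ε → ε ≤ ε₀ → ∀ w : Circle,
      M ≤ ∫ z, (ε + K * dist z w)⁻¹ ∂circleMeasure := by
  -- This value makes `K⁻¹ log (K π / ε₀) = 2 π |M|`; the factor `2 π` undoes the normalization of
  -- the measure.
  refine ⟨K * Real.pi / Real.exp (2 * Real.pi * K * |M|), by positivity, ?_⟩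
  intro ε hε hle w
  have hπ := Real.pi_pos
  set t := Complex.arg (w : ℂ)
  have ht1 : -Real.pi < t := Complex.neg_pi_lt_arg _
  have ht2 : t ≤ Real.pi := Complex.arg_le_pi _
  have hw : Circle.exp t = w := Circle.exp_arg w
  have hden : ∀ z, 0 < ε + K * dist z w := fun z => by positivity
  have hcont : Continuous fun z : Circle => (ε + K * dist z w)⁻¹ :=
    Continuous.inv₀ (by fun_prop) fun z => (hden z).ne'
  rw [integral_circleMeasure hcont]
  have hcont' : Continuous fun s : ℝ => (ε + K * dist (Circle.exp s) w)⁻¹ :=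
    hcont.comp Circle.exp.continuous
  have hii : ∀ a b, IntervalIntegrable
      (fun s : ℝ => (ε + K * dist (Circle.exp s) w)⁻¹) volume a b :=
    fun a b => hcont'.intervalIntegrable a b
  have hpt : ∀ s, (ε + K * |s - t|)⁻¹ ≤ (ε + K * dist (Circle.exp s) w)⁻¹ := by
    intro s
    have h := dist_circleExp_le s t
    rw [hw] at h
    have := hden (Circle.exp s)
    gcongr
  have hc2 : Continuous fun s : ℝ => (ε + K * |s - t|)⁻¹ :=
    Continuous.inv₀ (by fun_prop) fun s => by positivity
  have hlog : 2 * Real.pi * |M| ≤ ∫ s in (0 : ℝ)..Real.pi, (ε + K * s)⁻¹ := by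
    rw [integral_inv_add_mul hK hε, le_inv_mul_iff₀ hK, Real.le_log_iff_exp_le (by positivity),
      le_div_iff₀ hε]
    rw [le_div_iff₀ (by positivity)] at hle
    calc Real.exp (K * (2 * Real.pi * |M|)) * ε = ε * Real.exp (2 * Real.pi * K * |M|) := by
          rw [mul_comm]; congr 2; ring
      _ ≤ K * Real.pi := hle
      _ ≤ _ := by linarith
  have hmain : 2 * Real.pi * |M| ≤
      ∫ s in -Real.pi..Real.pi, (ε + K * dist (Circle.exp s) w)⁻¹ := by
    have hnn : ∀ s : ℝ, 0 ≤ (ε + K * dist (Circle.exp s) w)⁻¹ := fun s => (inv_pos.2 (hden _)).le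
    -- An interval of length `π` ending or starting at `t` fits inside `[-π, π]`, according to the
    -- sign of `t`.
    rcases le_total 0 t with h0 | h0
    · calc 2 * Real.pi * |M| ≤ ∫ s in (0 : ℝ)..Real.pi, (ε + K * s)⁻¹ := hlog
        _ = ∫ s in (t - Real.pi)..t, (ε + K * (t - s))⁻¹ := by
            rw [intervalIntegral.integral_comp_sub_left (fun s => (ε + K * s)⁻¹) t]
            simp
        _ = ∫ s in (t - Real.pi)..t, (ε + K * |s - t|)⁻¹ := by
            refine intervalIntegral.integral_congr fun s hs => ?_
            rw [Set.uIcc_of_le (by linarith)] at hs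
            rw [abs_of_nonpos (by linarith [hs.2]), neg_sub]
        _ ≤ ∫ s in (t - Real.pi)..t, (ε + K * dist (Circle.exp s) w)⁻¹ :=
            intervalIntegral.integral_mono (by linarith) (hc2.intervalIntegrable _ _) (hii _ _) hpt
        _ ≤ _ := intervalIntegral.integral_mono_interval (by linarith) (by linarith) ht2
            (Filter.Eventually.of_forall hnn) (hii _ _)
    · calc 2 * Real.pi * |M| ≤ ∫ s in (0 : ℝ)..Real.pi, (ε + K * s)⁻¹ := hlog
        _ = ∫ s in t..(t + Real.pi), (ε + K * (s - t))⁻¹ := by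
            rw [intervalIntegral.integral_comp_sub_right (fun s => (ε + K * s)⁻¹) t]
            simp
        _ = ∫ s in t..(t + Real.pi), (ε + K * |s - t|)⁻¹ := by
            refine intervalIntegral.integral_congr fun s hs => ?_
            rw [Set.uIcc_of_le (by linarith)] at hs
            rw [abs_of_nonneg (by linarith [hs.1])]
        _ ≤ ∫ s in t..(t + Real.pi), (ε + K * dist (Circle.exp s) w)⁻¹ :=
            intervalIntegral.integral_mono (by linarith) (hc2.intervalIntegrable _ _) (hii _ _) hpt
        _ ≤ _ := intervalIntegral.integral_mono_interval ht1.le (by linarith) (by linarith)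
            (Filter.Eventually.of_forall hnn) (hii _ _)
  rw [le_inv_mul_iff₀ (by positivity)]
  exact (mul_le_mul_of_nonneg_left (le_abs_self M) (by positivity)).trans hmain

end

/-! ### Transfer function, quadratic forms and state covariances. -/

section

variable {n : ℕ} {A : Matrix (Fin n) (Fin n) ℂ} {b : Fin n → ℂ}

theorem IsStabilityMatrix.isUnit_det (hA : IsStabilityMatrix A) (z : Circle) :
    IsUnit ((z : ℂ) • (1 : Matrix (Fin n) (Fin n) ℂ) - A).det := by
  rw [← Matrix.isUnit_iff_isUnit_det, ← Algebra.algebraMap_eq_smul_one]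
  by_contra h
  exact absurd (hA z h) (by rw [Circle.norm_coe]; exact lt_irrefl _)

theorem IsStabilityMatrix.mulVec_G (hA : IsStabilityMatrix A) (z : Circle) :
    A *ᵥ G A b z = (z : ℂ) • G A b z - b := by
  have h : ((z : ℂ) • (1 : Matrix (Fin n) (Fin n) ℂ) - A) *ᵥ G A b z = b := by
    rw [G, mulVec_mulVec, mul_nonsing_inv _ (hA.isUnit_det z), one_mulVec]
  rw [sub_mulVec, smul_mulVec, one_mulVec] at h
  exact (sub_eq_of_eq_add (sub_eq_iff_eq_add'.1 h)).symm

theorem IsStabilityMatrix.eq_smul_G (hA : IsStabilityMatrix A) (z : Circle) {g : Fin n → ℂ} {β : ℂ}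
    (h : A *ᵥ g = (z : ℂ) • g - β • b) : g = β • G A b z := by
  have h' : ((z : ℂ) • (1 : Matrix (Fin n) (Fin n) ℂ) - A) *ᵥ g = β • b := by
    rw [sub_mulVec, smul_mulVec, one_mulVec, h]; abel
  rw [G, ← mulVec_smul, ← h', mulVec_mulVec, nonsing_inv_mul _ (hA.isUnit_det z), one_mulVec]

theorem IsStabilityMatrix.G_ne_zero (hA : IsStabilityMatrix A) (hb : b ≠ 0) (z : Circle) :
    G A b z ≠ 0 := by
  intro h
  have := hA.mulVec_G (b := b) z
  rw [h] at this
  simp at this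
  exact hb this

theorem IsStabilityMatrix.continuous_inv (hA : IsStabilityMatrix A) :
    Continuous fun z : Circle => ((z : ℂ) • (1 : Matrix (Fin n) (Fin n) ℂ) - A)⁻¹ := by
  have h0 : Continuous fun z : Circle => ((z : ℂ) • (1 : Matrix (Fin n) (Fin n) ℂ) - A) := by
    fun_prop
  simp only [Matrix.inv_def, Ring.inverse_eq_inv']
  exact (h0.matrix_det.inv₀ fun z => (hA.isUnit_det z).ne_zero).smul h0.matrix_adjugate

theorem IsStabilityMatrix.continuous_G (hA : IsStabilityMatrix A) : Continuous (G A b) :=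
  hA.continuous_inv.matrix_mulVec continuous_const

@[fun_prop]
theorem IsStabilityMatrix.continuous_G_apply (hA : IsStabilityMatrix A) (i : Fin n) :
    Continuous fun z => G A b z i :=
  (continuous_apply i).comp hA.continuous_G

theorem exists_norm_le_of_continuous {ι : Type*} [Finite ι] {f : ι → Circle → ℂ}
    (hf : ∀ i, Continuous (f i)) : ∃ M, 0 ≤ M ∧ ∀ i z, ‖f i z‖ ≤ M := by
  cases nonempty_fintype ι
  have hi : ∀ i, ∃ C, ∀ z, ‖f i z‖ ≤ C := fun i => by
    obtain ⟨C, hC⟩ := isCompact_univ.exists_bound_of_continuousOn (hf i).continuousOn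
    exact ⟨C, fun z => hC z trivial⟩
  choose C hC using hi
  refine ⟨∑ i, |C i|, by positivity, fun i z => (hC i z).trans ((le_abs_self _).trans ?_)⟩
  exact Finset.single_le_sum (f := fun i => |C i|) (fun _ _ => abs_nonneg _) (Finset.mem_univ i)

theorem IsStabilityMatrix.exists_norm_G_le (hA : IsStabilityMatrix A) :
    ∃ M, 0 ≤ M ∧ ∀ i z, ‖G A b z i‖ ≤ M :=
  exists_norm_le_of_continuous fun i => hA.continuous_G_apply i

/-- The resolvent identity; with the bounded resolvent on the circle it makes `G` Lipschitz. -/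
theorem IsStabilityMatrix.G_sub_G (hA : IsStabilityMatrix A) (z w : Circle) :
    G A b z - G A b w =
      ((w : ℂ) - z) • (((z : ℂ) • (1 : Matrix (Fin n) (Fin n) ℂ) - A)⁻¹ *ᵥ G A b w) := by
  have h : b - ((z : ℂ) • (1 : Matrix (Fin n) (Fin n) ℂ) - A) *ᵥ G A b w
      = ((w : ℂ) - z) • G A b w := by
    rw [sub_mulVec, smul_mulVec, one_mulVec, hA.mulVec_G, sub_smul]; abel
  rw [← mulVec_smul, ← h, mulVec_sub, mulVec_mulVec, nonsing_inv_mul _ (hA.isUnit_det z),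
    one_mulVec]
  rfl

theorem IsStabilityMatrix.exists_lipschitz_G (hA : IsStabilityMatrix A) :
    ∃ K, 0 ≤ K ∧ ∀ i z w, ‖G A b z i - G A b w i‖ ≤ K * dist z w := by
  obtain ⟨M, hM0, hM⟩ := hA.exists_norm_G_le (b := b)
  obtain ⟨N, hN0, hN⟩ := exists_norm_le_of_continuous
    (f := fun (p : Fin n × Fin n) (z : Circle) =>
      ((z : ℂ) • (1 : Matrix (Fin n) (Fin n) ℂ) - A)⁻¹ p.1 p.2)
    fun p => (continuous_apply p.2).comp ((continuous_apply p.1).comp hA.continuous_inv)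
  refine ⟨∑ _j : Fin n, N * M, by positivity, fun i z w => ?_⟩
  have h := congrFun (hA.G_sub_G (b := b) z w) i
  rw [Pi.sub_apply] at h
  have hd : ‖(w : ℂ) - z‖ = dist z w := by
    rw [dist_comm]; exact (dist_eq_norm (w : ℂ) z).symm
  rw [h, Pi.smul_apply, smul_eq_mul, norm_mul, hd, mul_comm]
  refine mul_le_mul_of_nonneg_right ?_ dist_nonneg
  rw [mulVec, dotProduct]
  refine (norm_sum_le _ _).trans (Finset.sum_le_sum fun j _ => ?_)
  rw [norm_mul]
  exact mul_le_mul (hN (i, j) z) (hM j w) (norm_nonneg _) hN0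

theorem quadForm_eq_sum (L : Matrix (Fin n) (Fin n) ℂ) (z : Circle) :
    quadForm A b L z = ∑ i, ∑ j, (star (G A b z i) * G A b z j * L i j).re := by
  simp only [quadForm, dotProduct, mulVec, Finset.mul_sum, Complex.re_sum, Pi.star_apply]
  exact Finset.sum_congr rfl fun i _ => Finset.sum_congr rfl fun j _ => by ring_nf

theorem IsStabilityMatrix.continuous_quadForm (hA : IsStabilityMatrix A)
    (L : Matrix (Fin n) (Fin n) ℂ) : Continuous (quadForm A b L) := by
  have hG := fun i => hA.continuous_G_apply (b := b) i
  rw [show quadForm A b L = _ from funext (quadForm_eq_sum L)]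
  fun_prop

/-- The map `L ↦ G* L G`, with values in the continuous functions on the circle. -/
def quadMap (hA : IsStabilityMatrix A) (b : Fin n → ℂ) :
    Matrix (Fin n) (Fin n) ℂ →ₗ[ℝ] C(Circle, ℝ) where
  toFun L := ⟨quadForm A b L, hA.continuous_quadForm L⟩
  map_add' L M := by
    ext z
    simp [quadForm, add_mulVec]
  map_smul' r L := by
    ext z
    simp [quadForm, smul_mulVec]

@[simp]
theorem quadMap_apply (hA : IsStabilityMatrix A) (L : Matrix (Fin n) (Fin n) ℂ) (z : Circle) :
    quadMap hA b L z = quadForm A b L z := rfl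

theorem IsStabilityMatrix.exists_lipschitz_quadForm (hA : IsStabilityMatrix A) :
    ∃ K, 0 ≤ K ∧ ∀ (L : Matrix (Fin n) (Fin n) ℂ) (r : ℝ), (∀ i j, ‖L i j‖ ≤ r) →
      ∀ z w, |quadForm A b L z - quadForm A b L w| ≤ K * r * dist z w := by
  obtain ⟨M, hM0, hM⟩ := hA.exists_norm_G_le (b := b)
  obtain ⟨K, hK0, hK⟩ := hA.exists_lipschitz_G (b := b)
  refine ⟨∑ _i : Fin n, ∑ _j : Fin n, 2 * M * K, by positivity, fun L r hr z w => ?_⟩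
  rw [quadForm_eq_sum, quadForm_eq_sum, ← Finset.sum_sub_distrib, Finset.sum_mul, Finset.sum_mul]
  refine (Finset.abs_sum_le_sum_abs _ _).trans (Finset.sum_le_sum fun i _ => ?_)
  rw [← Finset.sum_sub_distrib, Finset.sum_mul, Finset.sum_mul]
  refine (Finset.abs_sum_le_sum_abs _ _).trans (Finset.sum_le_sum fun j _ => ?_)
  rw [← Complex.sub_re]
  refine (Complex.abs_re_le_norm _).trans ?_
  have h : star (G A b z i) * G A b z j * L i j - star (G A b w i) * G A b w j * L i j
      = (star (G A b z i - G A b w i) * G A b z j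
        + star (G A b w i) * (G A b z j - G A b w j)) * L i j := by
    rw [star_sub]; ring
  rw [h, norm_mul]
  have hr0 : 0 ≤ r := (norm_nonneg _).trans (hr i j)
  calc _ ≤ (K * dist z w * M + M * (K * dist z w)) * r := by
        refine mul_le_mul ((norm_add_le _ _).trans (add_le_add ?_ ?_)) (hr i j) (norm_nonneg _)
          (by positivity)
        · rw [norm_mul, norm_star]
          exact mul_le_mul (hK i z w) (hM j z) (norm_nonneg _) (by positivity)
        · rw [norm_mul, norm_star]
          exact mul_le_mul (hM i w) (hK j z w) (norm_nonneg _) hM0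
    _ = _ := by ring

theorem IsStabilityMatrix.integrable_mul (hA : IsStabilityMatrix A) {Φ : Circle → ℝ}
    (hΦ : Integrable Φ circleMeasure) (i j : Fin n) :
    Integrable (fun z => G A b z i * (Φ z : ℂ) * star (G A b z j)) circleMeasure := by
  obtain ⟨M, hM0, hM⟩ := hA.exists_norm_G_le (b := b)
  have h1 : Integrable (fun z => (G A b z i * star (G A b z j)) * (Φ z : ℂ)) circleMeasure := by
    refine hΦ.ofReal.bdd_mul (c := M * M) ?_ (Filter.Eventually.of_forall fun z => ?_)
    · exact ((hA.continuous_G_apply i).mul (hA.continuous_G_apply j).star).aestronglyMeasurable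
    · rw [norm_mul, norm_star]
      exact mul_le_mul (hM i z) (hM j z) (norm_nonneg _) hM0
  exact h1.congr (Filter.Eventually.of_forall fun z => by ring)

theorem IsStabilityMatrix.trace_mul_stateCov (hA : IsStabilityMatrix A) {Φ : Circle → ℝ}
    (hΦ : Integrable Φ circleMeasure) (L : Matrix (Fin n) (Fin n) ℂ) :
    (L * stateCov A b Φ).trace =
      ∫ z, (Φ z : ℂ) * (star (G A b z) ⬝ᵥ (L *ᵥ G A b z)) ∂circleMeasure := by
  have hint := fun i j => hA.integrable_mul (b := b) hΦ i j
  simp only [trace, diag, mul_apply, stateCov, of_apply, dotProduct, mulVec, Finset.mul_sum]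
  rw [integral_finsetSum _ fun i _ => ?_]
  · refine Finset.sum_congr rfl fun i _ => ?_
    rw [integral_finsetSum _ fun j _ => ?_]
    · refine Finset.sum_congr rfl fun j _ => ?_
      rw [← integral_const_mul]
      refine integral_congr_ae (Filter.Eventually.of_forall fun z => ?_)
      simp only [Pi.star_apply]; ring
    · refine ((hint j i).const_mul (L i j)).congr (Filter.Eventually.of_forall fun z => ?_)
      simp only [Pi.star_apply]; ring
  · refine integrable_finsetSum _ fun j _ => ?_
    refine ((hint j i).const_mul (L i j)).congr (Filter.Eventually.of_forall fun z => ?_)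
    simp only [Pi.star_apply]; ring

theorem IsStabilityMatrix.trace_mul_stateCov_re (hA : IsStabilityMatrix A) {Φ : Circle → ℝ}
    (hΦ : Integrable Φ circleMeasure) (L : Matrix (Fin n) (Fin n) ℂ) :
    (L * stateCov A b Φ).trace.re = ∫ z, Φ z * quadForm A b L z ∂circleMeasure := by
  have hint : Integrable (fun z => (Φ z : ℂ) * (star (G A b z) ⬝ᵥ (L *ᵥ G A b z)))
      circleMeasure := by
    simp only [dotProduct, mulVec, Finset.mul_sum]
    refine integrable_finsetSum _ fun i _ => integrable_finsetSum _ fun j _ => ?_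
    refine ((hA.integrable_mul (b := b) hΦ j i).const_mul (L i j)).congr
      (Filter.Eventually.of_forall fun z => ?_)
    simp only [Pi.star_apply]; ring
  rw [hA.trace_mul_stateCov hΦ]
  have := integral_re hint
  simp only [RCLike.re_eq_complex_re] at this
  rw [← this]
  simp [quadForm]

theorem stateCov_isHermitian (Φ : Circle → ℝ) : (stateCov A b Φ).IsHermitian := by
  ext i j
  simp only [stateCov, conjTranspose_apply, of_apply]
  have h := integral_conj (μ := circleMeasure)
    (f := fun z => G A b z j * (Φ z : ℂ) * star (G A b z i))
  simp only [starRingEnd_apply] at h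
  rw [← h]
  refine integral_congr_ae (Filter.Eventually.of_forall fun z => ?_)
  simp [mul_comm, mul_assoc]

theorem IsStabilityMatrix.stateCov_add (hA : IsStabilityMatrix A) {Φ Θ : Circle → ℝ}
    (hΦ : Integrable Φ circleMeasure) (hΘ : Integrable Θ circleMeasure) :
    stateCov A b (Φ + Θ) = stateCov A b Φ + stateCov A b Θ := by
  ext i j
  simp only [stateCov, Matrix.add_apply, of_apply]
  rw [← integral_add (hA.integrable_mul hΦ i j) (hA.integrable_mul hΘ i j)]
  refine integral_congr_ae (Filter.Eventually.of_forall fun z => ?_)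
  simp only [Pi.add_apply]; push_cast; ring

theorem stateCov_smul (r : ℝ) (Φ : Circle → ℝ) :
    stateCov A b (r • Φ) = r • stateCov A b Φ := by
  ext i j
  simp only [stateCov, Matrix.smul_apply, of_apply]
  rw [← integral_smul]
  refine integral_congr_ae (Filter.Eventually.of_forall fun z => ?_)
  simp only [Pi.smul_apply, smul_eq_mul, Complex.real_smul]; push_cast; ring

theorem integrable_coe (Φ : C(Circle, ℝ)) : Integrable Φ circleMeasure :=
  Φ.continuous.integrable_of_hasCompactSupport (HasCompactSupport.of_compactSpace _)

/-- The operator `Φ ↦ ∫ G Φ G*` on the continuous functions. -/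
def stateCovMap (hA : IsStabilityMatrix A) (b : Fin n → ℂ) :
    C(Circle, ℝ) →ₗ[ℝ] Matrix (Fin n) (Fin n) ℂ where
  toFun Φ := stateCov A b Φ
  map_add' Φ Θ := hA.stateCov_add (integrable_coe Φ) (integrable_coe Θ)
  map_smul' r Φ := stateCov_smul r Φ

/-- The range of `Φ ↦ ∫ G Φ G*`, as a real vector space. -/
def rangeSub (hA : IsStabilityMatrix A) (b : Fin n → ℂ) :
    Submodule ℝ (Matrix (Fin n) (Fin n) ℂ) :=
  LinearMap.range (stateCovMap hA b)

theorem isHermitian_of_mem_rangeGamma {L : Matrix (Fin n) (Fin n) ℂ} (hL : L ∈ rangeGamma A b) :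
    L.IsHermitian := by
  obtain ⟨Φ, rfl⟩ := hL
  exact stateCov_isHermitian _

theorem IsHermitian.eq_zero_of_trace_mul_self {L : Matrix (Fin n) (Fin n) ℂ}
    (hL : L.IsHermitian) (h : (L * L).trace.re = 0) : L = 0 := by
  rw [← Matrix.trace_conjTranspose_mul_self_eq_zero_iff, hL.eq]
  refine Complex.ext h ?_
  have h2 : star (L * L).trace = (L * L).trace := by
    rw [← trace_conjTranspose, conjTranspose_mul, hL.eq]
  exact Complex.conj_eq_iff_im.1 h2

theorem IsStabilityMatrix.eq_zero_of_quadForm (hA : IsStabilityMatrix A)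
    {L : Matrix (Fin n) (Fin n) ℂ} (hL : L ∈ rangeGamma A b) (h : ∀ z, quadForm A b L z = 0) :
    L = 0 := by
  refine IsHermitian.eq_zero_of_trace_mul_self (isHermitian_of_mem_rangeGamma hL) ?_
  obtain ⟨Φ, hΦ⟩ := hL
  nth_rewrite 2 [← hΦ]
  simp [hA.trace_mul_stateCov_re (integrable_coe Φ), h]

/-- Every matrix has the same quadratic form as some element of the range of `Γ`, namely as its
orthogonal projection. -/
theorem IsStabilityMatrix.exists_mem_quadForm_eq (hA : IsStabilityMatrix A)
    (H : Matrix (Fin n) (Fin n) ℂ) :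
    ∃ L ∈ rangeGamma A b, (∀ z, quadForm A b L z = quadForm A b H z) ∧
      ∀ M ∈ rangeGamma A b, (L * M).trace.re = (H * M).trace.re := by
  let T : Matrix (Fin n) (Fin n) ℂ →ₗ[ℝ] Module.Dual ℝ (rangeSub hA b) :=
    LinearMap.mk₂ ℝ (fun L (M : rangeSub hA b) => (L * M).trace.re)
      (by intros; simp [add_mul]) (by intros; simp)
      (by intros; simp [mul_add]) (by intros; simp)
  -- The trace pairing is definite on the Hermitian matrices of the range, so by dimension it
  -- represents every functional on the range, in particular the one given by `H`.
  have hinj : Function.Injective (T.comp (rangeSub hA b).subtype) := by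
    rw [injective_iff_map_eq_zero]
    intro L hL
    have h0 := LinearMap.congr_fun hL L
    exact Subtype.ext (IsHermitian.eq_zero_of_trace_mul_self
      (isHermitian_of_mem_rangeGamma L.2) h0)
  have hsurj : Function.Surjective (T.comp (rangeSub hA b).subtype) :=
    (LinearMap.injective_iff_surjective_of_finrank_eq_finrank
      (Subspace.dual_finrank_eq).symm).1 hinj
  obtain ⟨L, hL⟩ := hsurj (T H)
  have htr : ∀ M ∈ rangeGamma A b, ((L : Matrix (Fin n) (Fin n) ℂ) * M).trace.re
      = (H * M).trace.re := fun M hM => LinearMap.congr_fun hL ⟨M, hM⟩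
  refine ⟨L, L.2, fun z => ?_, htr⟩
  -- Testing the trace identity against `∫ G d G*`, with `d` the difference of the two forms, gives
  -- `∫ d² = 0`.
  let d : C(Circle, ℝ) := quadMap hA b (L - H)
  have hd : ∫ z, d z * d z ∂circleMeasure = 0 := by
    have := htr _ ⟨d, rfl⟩
    rw [← sub_eq_zero, ← Complex.sub_re, ← trace_sub, ← sub_mul,
      hA.trace_mul_stateCov_re (integrable_coe d)] at this
    exact this
  have hz : (fun z => d z * d z) = 0 :=
    Continuous.ae_eq_iff_eq circleMeasure (by fun_prop) continuous_const |>.1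
      ((integral_eq_zero_iff_of_nonneg (fun z => mul_self_nonneg (d z))
        (integrable_coe (d * d))).1 hd)
  have hz' : d z = 0 := mul_self_eq_zero.1 (congrFun hz z)
  have : d z = quadForm A b L z - quadForm A b H z := by
    simp [d]
  linarith

theorem IsStabilityMatrix.dotProduct_stateCov (hA : IsStabilityMatrix A) {Φ : Circle → ℝ}
    (hΦ : Integrable Φ circleMeasure) (c d : Fin n → ℂ) :
    star c ⬝ᵥ (stateCov A b Φ *ᵥ d) =
      ∫ z, (Φ z : ℂ) * ((star c ⬝ᵥ G A b z) * (star (G A b z) ⬝ᵥ d)) ∂circleMeasure := by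
  have h := hA.trace_mul_stateCov (b := b) hΦ (vecMulVec d (star c))
  rw [vecMulVec_mul, trace_vecMulVec, dotProduct_comm, ← dotProduct_mulVec] at h
  rw [h]
  refine integral_congr_ae (Filter.Eventually.of_forall fun z => ?_)
  simp only [vecMulVec_mulVec, dotProduct_smul, MulOpposite.smul_eq_mul_unop,
    MulOpposite.unop_op]
  ring

/-- On the vectors orthogonal to `b`, the adjoint of `A` is isometric for the form of a state
covariance. -/
theorem IsStabilityMatrix.dotProduct_stateCov_adjoint (hA : IsStabilityMatrix A) {Φ : Circle → ℝ}
    (hΦ : Integrable Φ circleMeasure) {c d : Fin n → ℂ} (hc : star c ⬝ᵥ b = 0)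
    (hd : star d ⬝ᵥ b = 0) :
    star (Aᴴ *ᵥ c) ⬝ᵥ (stateCov A b Φ *ᵥ (Aᴴ *ᵥ d)) = star c ⬝ᵥ (stateCov A b Φ *ᵥ d) := by
  -- For `e` orthogonal to `b`, the relation `A G = z G - b` turns `Aᴴ` into multiplication by `z`,
  -- which disappears from the integral since `|z| = 1`.
  have key : ∀ (e : Fin n → ℂ), star e ⬝ᵥ b = 0 → ∀ z : Circle,
      star (Aᴴ *ᵥ e) ⬝ᵥ G A b z = z * (star e ⬝ᵥ G A b z) := by
    intro e he z
    rw [star_mulVec, conjTranspose_conjTranspose, ← dotProduct_mulVec, hA.mulVec_G,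
      dotProduct_sub, he, dotProduct_smul, sub_zero, smul_eq_mul]
  have key' : ∀ z : Circle, star (G A b z) ⬝ᵥ (Aᴴ *ᵥ d)
      = star (z : ℂ) * (star (G A b z) ⬝ᵥ d) := by
    intro z
    have := congrArg star (key d hd z)
    rw [star_mul'] at this
    simpa only [← star_dotProduct] using this
  rw [hA.dotProduct_stateCov hΦ, hA.dotProduct_stateCov hΦ]
  refine integral_congr_ae (Filter.Eventually.of_forall fun z => ?_)
  simp only [key c hc, key']
  have hz : (z : ℂ) * star (z : ℂ) = 1 := by
    rw [← starRingEnd_apply, Complex.mul_conj, Circle.normSq_coe, Complex.ofReal_one]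
  linear_combination ((Φ z : ℂ) * ((star c ⬝ᵥ G A b z) * (star (G A b z) ⬝ᵥ d))) * hz

end

/-! ### Diagonalization of isometries and rank one decomposition of covariances. -/

section

section Isometry

open Module Module.End

variable {E : Type*} [NormedAddCommGroup E] [InnerProductSpace ℂ E]

theorem norm_eq_one_of_hasEigenvalue (U : E →ₗᵢ[ℂ] E) {μ : ℂ}
    (h : HasEigenvalue U.toLinearMap μ) : ‖μ‖ = 1 := by
  obtain ⟨v, hv, hv0⟩ := h.exists_hasEigenvector
  rw [mem_eigenspace_iff] at hv
  have h1 : ‖U v‖ = ‖v‖ := U.norm_map v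
  rw [← LinearIsometry.coe_toLinearMap, hv, norm_smul] at h1
  exact (mul_eq_right₀ (norm_ne_zero_iff.2 hv0)).1 h1

/-- An eigenvector of `U` is one of its adjoint as well; hence distinct eigenspaces are orthogonal
and the orthogonal complement of their sum is invariant. -/
theorem inner_of_mem_eigenspace (U : E →ₗᵢ[ℂ] E) {μ : ℂ} (hμ : ‖μ‖ = 1) {v : E}
    (hv : v ∈ eigenspace U.toLinearMap μ) (x : E) : inner ℂ v (U x) = μ * inner ℂ v x := by
  rw [mem_eigenspace_iff] at hv
  have h := U.inner_map_map v x
  rw [← LinearIsometry.coe_toLinearMap, hv, inner_smul_left] at h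
  rw [← h, ← mul_assoc, Complex.mul_conj, Complex.normSq_eq_norm_sq, hμ]
  simp

theorem orthogonalFamily_eigenspaces_isometry (U : E →ₗᵢ[ℂ] E) :
    OrthogonalFamily ℂ (fun μ : Eigenvalues U.toLinearMap => eigenspace U.toLinearMap μ)
      fun μ => (eigenspace U.toLinearMap (μ : ℂ)).subtypeₗᵢ := by
  rintro μ ν hμν ⟨v, hv⟩ ⟨w, hw⟩
  have h := inner_of_mem_eigenspace U (norm_eq_one_of_hasEigenvalue U μ.2) hv w
  rw [mem_eigenspace_iff] at hw
  rw [← LinearIsometry.coe_toLinearMap, hw, inner_smul_right] at h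
  refine (mul_eq_mul_right_iff.1 h).resolve_left fun h' => hμν (Subtype.ext h'.symm)

theorem orthogonal_iSup_eigenspaces_isometry [FiniteDimensional ℂ E] (U : E →ₗᵢ[ℂ] E) :
    (⨆ μ : Eigenvalues U.toLinearMap, eigenspace U.toLinearMap (μ : ℂ))ᗮ = ⊥ := by
  set W := (⨆ μ : Eigenvalues U.toLinearMap, eigenspace U.toLinearMap (μ : ℂ))ᗮ with hW
  have hinv : ∀ v ∈ W, U.toLinearMap v ∈ W := by
    rw [hW, ← Submodule.iInf_orthogonal]
    intro v hv
    rw [Submodule.mem_iInf] at hv ⊢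
    intro μ w hw
    rw [LinearIsometry.coe_toLinearMap,
      inner_of_mem_eigenspace U (norm_eq_one_of_hasEigenvalue U μ.2) hw, hv μ w hw, mul_zero]
  by_contra hne
  have : Nontrivial W := Submodule.nontrivial_iff_ne_bot.2 hne
  obtain ⟨μ, hμ⟩ := exists_eigenvalue (U.toLinearMap.restrict hinv)
  obtain ⟨v, hv, hv0⟩ := hμ.exists_hasEigenvector
  rw [mem_eigenspace_iff] at hv
  have hv' : (v : E) ∈ eigenspace U.toLinearMap μ := by
    rw [mem_eigenspace_iff]
    exact congrArg Subtype.val hv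
  have hv0' : (v : E) ≠ 0 := fun h => hv0 (Subtype.ext h)
  have hμ' : HasEigenvalue U.toLinearMap μ := hasEigenvalue_of_hasEigenvector ⟨hv', hv0'⟩
  have hmem : (v : E) ∈ ⨆ μ : Eigenvalues U.toLinearMap, eigenspace U.toLinearMap (μ : ℂ) :=
    Submodule.mem_iSup_of_mem (⟨μ, hμ'⟩ : Eigenvalues U.toLinearMap) hv'
  exact hv0' (inner_self_eq_zero.1 (v.2 _ hmem))

/-- A linear isometry of a finite-dimensional complex inner product space has an orthonormal basis
of eigenvectors. -/
theorem exists_orthonormalBasis_eigenvectors [FiniteDimensional ℂ E] (U : E →ₗᵢ[ℂ] E) :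
    ∃ (v : OrthonormalBasis (Fin (finrank ℂ E)) ℂ E) (μ : Fin (finrank ℂ E) → ℂ),
      ∀ i, ‖μ i‖ = 1 ∧ v i ∈ eigenspace U.toLinearMap (μ i) := by
  classical
  have hint := (orthogonalFamily_eigenspaces_isometry U).isInternal_iff.2
    (orthogonal_iSup_eigenspaces_isometry U)
  refine ⟨hint.subordinateOrthonormalBasis rfl (orthogonalFamily_eigenspaces_isometry U),
    fun i => (hint.subordinateOrthonormalBasisIndex rfl i
      (orthogonalFamily_eigenspaces_isometry U) : Eigenvalues U.toLinearMap), fun i => ⟨?_, ?_⟩⟩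
  · exact norm_eq_one_of_hasEigenvalue U (Subtype.prop _)
  · exact hint.subordinateOrthonormalBasis_subordinate rfl i
      (orthogonalFamily_eigenspaces_isometry U)

end Isometry

variable {n : ℕ} {A : Matrix (Fin n) (Fin n) ℂ} {b : Fin n → ℂ}

theorem inner_toLp (x y : Fin n → ℂ) :
    inner ℂ (WithLp.toLp 2 x) (WithLp.toLp 2 y) = star x ⬝ᵥ y := by
  rw [EuclideanSpace.inner_eq_star_dotProduct, dotProduct_comm]

theorem exists_eq_smul_of_forall_orthogonal {b g : Fin n → ℂ}
    (h : ∀ c : Fin n → ℂ, star b ⬝ᵥ c = 0 → star g ⬝ᵥ c = 0) : ∃ β : ℂ, g = β • b := by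
  have hmem : WithLp.toLp 2 g ∈ (ℂ ∙ (WithLp.toLp 2 b : EuclideanSpace ℂ (Fin n)))ᗮᗮ := by
    intro x hx
    rw [Submodule.mem_orthogonal_singleton_iff_inner_right] at hx
    rw [← inner_conj_symm]
    have := h x.ofLp (by rw [← inner_toLp]; exact hx)
    rw [← inner_toLp] at this
    rw [show x = WithLp.toLp 2 x.ofLp from rfl, this, map_zero]
  rw [Submodule.orthogonal_orthogonal, Submodule.mem_span_singleton] at hmem
  obtain ⟨β, hβ⟩ := hmem
  exact ⟨β, (congrArg WithLp.ofLp hβ).symm⟩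

open scoped MatrixOrder in
/-- A positive definite state covariance is a finite sum of rank one state covariances `G G*`
at points of the circle. -/
theorem IsStabilityMatrix.exists_sum_vecMulVec (hA : IsStabilityMatrix A) {Φ : Circle → ℝ}
    (hΦ : Integrable Φ circleMeasure) (hS : (stateCov A b Φ).PosDef) :
    ∃ (m : ℕ) (β : Fin m → ℂ) (z : Fin m → Circle),
      stateCov A b Φ = ∑ k, vecMulVec (β k • G A b (z k)) (star (β k • G A b (z k))) := by
  set S := stateCov A b Φ with hSdef
  obtain ⟨R, hRu, hR⟩ : ∃ R : Matrix (Fin n) (Fin n) ℂ, IsUnit R ∧ S = Rᴴ * R := by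
    obtain ⟨R, hRu, hR⟩ :=
      CStarAlgebra.isStrictlyPositive_iff_eq_star_mul_self.mp hS.isStrictlyPositive
    exact ⟨R, hRu, hR⟩
  have hdet : IsUnit R.det := (Matrix.isUnit_iff_isUnit_det R).1 hRu
  have hSR : ∀ c d : Fin n → ℂ, star c ⬝ᵥ (S *ᵥ d) = star (R *ᵥ c) ⬝ᵥ (R *ᵥ d) := by
    intro c d
    rw [hR, ← mulVec_mulVec, dotProduct_mulVec, star_mulVec]
  have hRR : ∀ c : Fin n → ℂ, R⁻¹ *ᵥ (R *ᵥ c) = c := by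
    intro c
    rw [mulVec_mulVec, nonsing_inv_mul _ hdet, one_mulVec]
  have hRR' : ∀ c : Fin n → ℂ, R *ᵥ (R⁻¹ *ᵥ c) = c := by
    intro c
    rw [mulVec_mulVec, mul_nonsing_inv _ hdet, one_mulVec]
  -- The image under `R` of the orthogonal complement of `b`. As `S = Rᴴ R`, the map `R` carries the
  -- form of `S` to the standard inner product, so `R Aᴴ R⁻¹` is isometric on `M`.
  let M : Submodule ℂ (EuclideanSpace ℂ (Fin n)) :=
    { carrier := {x | star b ⬝ᵥ (R⁻¹ *ᵥ x.ofLp) = 0}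
      add_mem' := fun {x y} hx hy => by
        simp only [Set.mem_ofPred_eq] at hx hy ⊢
        rw [WithLp.ofLp_add, mulVec_add, dotProduct_add, hx, hy, add_zero]
      zero_mem' := by simp
      smul_mem' := fun r x hx => by
        simp only [Set.mem_ofPred_eq] at hx ⊢
        rw [WithLp.ofLp_smul, mulVec_smul, dotProduct_smul, hx, smul_zero] }
  have hM : ∀ c, star b ⬝ᵥ c = 0 → WithLp.toLp 2 (R *ᵥ c) ∈ M := by
    intro c hc
    change star b ⬝ᵥ (R⁻¹ *ᵥ (R *ᵥ c)) = 0
    rw [hRR, hc]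
  let T : EuclideanSpace ℂ (Fin n) →ₗ[ℂ] EuclideanSpace ℂ (Fin n) :=
    Matrix.toLpLin 2 2 (R * Aᴴ * R⁻¹)
  have hT : ∀ x, T x = WithLp.toLp 2 (R *ᵥ (Aᴴ *ᵥ (R⁻¹ *ᵥ x.ofLp))) := by
    intro x
    simp only [T, Matrix.toLpLin_apply, mulVec_mulVec, mul_assoc]
  let V : M →ₗᵢ[ℂ] EuclideanSpace ℂ (Fin n) :=
    { toLinearMap := T.comp M.subtype
      norm_map' := fun x => by
        have hx : star b ⬝ᵥ (R⁻¹ *ᵥ (x : EuclideanSpace ℂ (Fin n)).ofLp) = 0 := x.2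
        have hx' : star (R⁻¹ *ᵥ (x : EuclideanSpace ℂ (Fin n)).ofLp) ⬝ᵥ b = 0 := by
          rw [star_dotProduct, hx, star_zero]
        have h := hA.dotProduct_stateCov_adjoint hΦ hx' hx'
        rw [← hSdef, hSR, hSR, hRR', ← inner_toLp, ← inner_toLp] at h
        rw [LinearMap.comp_apply, Submodule.subtype_apply, hT, ← Submodule.norm_coe,
          @norm_eq_sqrt_re_inner ℂ, h, ← @norm_eq_sqrt_re_inner ℂ] }
  have hV : ∀ c (hc : star b ⬝ᵥ c = 0),
      V.extend (WithLp.toLp 2 (R *ᵥ c)) = WithLp.toLp 2 (R *ᵥ (Aᴴ *ᵥ c)) := by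
    intro c hc
    rw [V.extend_apply ⟨_, hM c hc⟩]
    change T (WithLp.toLp 2 (R *ᵥ c)) = _
    rw [hT, hRR]
  obtain ⟨v, μ, hv⟩ := exists_orthonormalBasis_eigenvectors V.extend
  let z : Fin _ → Circle := fun k => ⟨star (μ k), by
    rw [Submonoid.unitSphere, ← SetLike.mem_coe]
    simpa using (hv k).1⟩
  -- Put `g = Rᴴ v`. The eigenvalue equation tested on `M` says that `z g - A g`, with `z` the
  -- conjugate eigenvalue, is orthogonal to every `c ⊥ b`. So it is a multiple of `b`, and `g` a
  -- multiple of `G(z)`.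
  have hg : ∀ k, ∃ β : ℂ, Rᴴ *ᵥ (v k).ofLp = β • G A b (z k) := by
    intro k
    obtain ⟨β, hβ⟩ := exists_eq_smul_of_forall_orthogonal
      (b := b) (g := (z k : ℂ) • (Rᴴ *ᵥ (v k).ofLp) - A *ᵥ (Rᴴ *ᵥ (v k).ofLp)) (by
        intro c hc
        have h := inner_of_mem_eigenspace V.extend (hv k).1 (hv k).2 (WithLp.toLp 2 (R *ᵥ c))
        rw [hV c hc, show v k = WithLp.toLp 2 (v k).ofLp from rfl, inner_toLp, inner_toLp] at h
        rw [star_sub, sub_dotProduct, star_smul, smul_dotProduct, star_mulVec A, star_mulVec,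
          conjTranspose_conjTranspose, ← dotProduct_mulVec, ← dotProduct_mulVec,
          ← dotProduct_mulVec, h, sub_eq_zero, smul_eq_mul]
        simp [z])
    exact ⟨β, hA.eq_smul_G _ (by rw [← hβ]; abel)⟩
  choose β hβ using hg
  refine ⟨_, β, z, ?_⟩
  simp only [← hβ]
  -- Completeness of the orthonormal eigenbasis; conjugating by `R` gives the decomposition of `S =
  -- Rᴴ 1 R`.
  have hone : (1 : Matrix (Fin n) (Fin n) ℂ)
      = ∑ k, vecMulVec (v k).ofLp (star (v k).ofLp) := by
    refine Matrix.ext_of_mulVec_single fun i => ?_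
    have h := v.sum_repr' (WithLp.toLp 2 (Pi.single i 1))
    have h' := congrArg WithLp.ofLp h
    rw [one_mulVec, sum_mulVec]
    refine h'.symm.trans ?_
    rw [WithLp.ofLp_sum]
    refine Finset.sum_congr rfl fun k _ => ?_
    rw [WithLp.ofLp_smul, show v k = WithLp.toLp 2 (v k).ofLp from rfl, inner_toLp,
      vecMulVec_mulVec]
    simp
  rw [hR]
  nth_rewrite 1 [← mul_one Rᴴ]
  rw [hone, Finset.mul_sum, Finset.sum_mul]
  refine Finset.sum_congr rfl fun k _ => ?_
  rw [mul_vecMulVec, vecMulVec_mul, star_mulVec, conjTranspose_conjTranspose]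

/-- The integral formula for the trace is no help when `Φ` is signed; in the rank one decomposition
each term contributes `|β|² (G* L G)(z) ≥ 0`. -/
theorem IsStabilityMatrix.trace_mul_re_nonneg (hA : IsStabilityMatrix A)
    {S : Matrix (Fin n) (Fin n) ℂ} (hS : S ∈ PGamma A b) {L : Matrix (Fin n) (Fin n) ℂ}
    (hL : ∀ z, 0 ≤ quadForm A b L z) : 0 ≤ (L * S).trace.re := by
  obtain ⟨⟨Φ, rfl⟩, hpos⟩ := hS
  obtain ⟨m, β, z, h⟩ := hA.exists_sum_vecMulVec (integrable_coe Φ) hpos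
  simp only at h ⊢
  rw [h, Finset.mul_sum, trace_sum, Complex.re_sum]
  refine Finset.sum_nonneg fun k _ => ?_
  rw [mul_vecMulVec, trace_vecMulVec, dotProduct_comm, mulVec_smul, star_smul, smul_dotProduct,
    dotProduct_smul, smul_smul, smul_eq_mul]
  have : star (β k) * β k = ((‖β k‖ ^ 2 : ℝ) : ℂ) := by
    rw [← Complex.normSq_eq_norm_sq, Complex.normSq_eq_conj_mul_self]; rfl
  rw [this, Complex.re_ofReal_mul]
  exact mul_nonneg (by positivity) (hL (z k))

end

/-! ### Abstract logarithmic barrier on a finite-dimensional cone. -/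

section

section LogBarrier

variable {X : Type*} [TopologicalSpace X]

theorem exists_pos_le_of_continuous [CompactSpace X] {g : X → ℝ} (hg : Continuous g)
    (h0 : ∀ x, 0 < g x) : ∃ m > 0, ∀ x, m ≤ g x := by
  rcases isEmpty_or_nonempty X with hX | hX
  · exact ⟨1, one_pos, fun x => isEmptyElim x⟩
  · obtain ⟨x, -, hx⟩ := isCompact_univ.exists_isMinOn Set.univ_nonempty hg.continuousOn
    exact ⟨g x, h0 x, fun y => hx (Set.mem_univ y)⟩

variable {E : Type*} [NormedAddCommGroup E] [NormedSpace ℝ E]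

/-- The elements of `E` that `q` maps to positive functions. -/
def posCone (q : E →L[ℝ] C(X, ℝ)) : Set E := {L | ∀ x, 0 < q L x}

theorem apply_le_norm_mul [CompactSpace X] (q : E →L[ℝ] C(X, ℝ)) (L : E) (x : X) :
    |q L x| ≤ ‖q‖ * ‖L‖ :=
  ((q L).norm_coe_le_norm x).trans (q.le_opNorm L)

variable [MeasurableSpace X] {μ : Measure X}

/-- The functional `L ↦ - ∫ Ψ log (q L) + σ L`. -/
def logBarrier (μ : Measure X) (q : E →L[ℝ] C(X, ℝ)) (Ψ : X → ℝ) (σ : E →L[ℝ] ℝ) (L : E) : ℝ :=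
  -(∫ x, Ψ x * Real.log (q L x) ∂μ) + σ L

/-- The stationarity condition of the functional `logBarrier`. -/
def IsStationary (μ : Measure X) (q : E →L[ℝ] C(X, ℝ)) (Ψ : X → ℝ) (σ : E →L[ℝ] ℝ) (L : E) :
    Prop :=
  ∀ h, ∫ x, Ψ x * (q h x / q L x) ∂μ = σ h

variable {q : E →L[ℝ] C(X, ℝ)} {Ψ : X → ℝ} {σ τ : E →L[ℝ] ℝ}

theorem IsStationary.apply_self {L : E} (hL : L ∈ posCone q) (h : IsStationary μ q Ψ σ L) :
    σ L = ∫ x, Ψ x ∂μ := by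
  rw [← h L]
  congr 1; ext x
  rw [div_self (hL x).ne', mul_one]

variable [CompactSpace X] [BorelSpace X]

theorem integrable_mul_continuous {Ψ g : X → ℝ} (hΨ : Integrable Ψ μ) (hg : Continuous g) :
    Integrable (fun x => Ψ x * g x) μ := by
  obtain ⟨C, hC⟩ := isCompact_univ.exists_bound_of_continuousOn hg.continuousOn
  exact hΨ.mul_bdd (c := C) hg.aestronglyMeasurable
    (Filter.Eventually.of_forall fun x => hC x trivial)

theorem integrable_mul_div (hΨ : Integrable Ψ μ) {L : E} (hL : L ∈ posCone q) (h : E) :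
    Integrable (fun x => Ψ x * (q h x / q L x)) μ :=
  integrable_mul_continuous hΨ ((q h).continuous.div (q L).continuous fun x => (hL x).ne')

theorem integrable_mul_log (hΨ : Integrable Ψ μ) {L : E} (hL : L ∈ posCone q) :
    Integrable (fun x => Ψ x * Real.log (q L x)) μ :=
  integrable_mul_continuous hΨ ((q L).continuous.log fun x => (hL x).ne')

/-- The gradient inequality of convexity, based at `M`; pointwise it is `1 - u⁻¹ ≤ log u` with `u =
q M / q L`. -/
theorem logBarrier_sub_le (hΨ : Integrable Ψ μ) (hΨ0 : ∀ᵐ x ∂μ, 0 ≤ Ψ x) {L M : E}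
    (hL : L ∈ posCone q) (hM : M ∈ posCone q) :
    logBarrier μ q Ψ σ M - logBarrier μ q Ψ σ L ≤
      σ (M - L) - ∫ x, Ψ x * (q (M - L) x / q M x) ∂μ := by
  have h : ∫ x, Ψ x * (q (M - L) x / q M x) ∂μ ≤
      (∫ x, Ψ x * Real.log (q M x) ∂μ) - ∫ x, Ψ x * Real.log (q L x) ∂μ := by
    rw [← integral_sub (integrable_mul_log hΨ hM) (integrable_mul_log hΨ hL)]
    refine integral_mono_ae (integrable_mul_div hΨ hM _)
      ((integrable_mul_log hΨ hM).sub (integrable_mul_log hΨ hL)) ?_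
    filter_upwards [hΨ0] with x hx
    rw [← mul_sub, ← Real.log_div (hM x).ne' (hL x).ne']
    refine mul_le_mul_of_nonneg_left ?_ hx
    have h1 := Real.one_sub_inv_le_log_of_pos (div_pos (hM x) (hL x))
    have h2 : q (M - L) x / q M x = 1 - (q M x / q L x)⁻¹ := by
      rw [map_sub, ContinuousMap.sub_apply, sub_div, div_self (hM x).ne', inv_div]
    rw [h2]; exact h1
  rw [logBarrier, logBarrier, map_sub]
  linarith

/-- The gradient inequality at `L + t h` replaces differentiation under the integral; an explicit
error of order `t` allows the limit `t → 0⁺`. -/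
theorem integral_le_of_isMinOn (hΨ : Integrable Ψ μ) (hΨ0 : ∀ᵐ x ∂μ, 0 ≤ Ψ x) {L : E}
    (hL : L ∈ posCone q) (hmin : IsMinOn (logBarrier μ q Ψ σ) (posCone q) L) (h : E) :
    ∫ x, Ψ x * (q h x / q L x) ∂μ ≤ σ h := by
  obtain ⟨m, hm0, hm⟩ := exists_pos_le_of_continuous (q L).continuous hL
  set B := ‖q h‖
  have hB : ∀ x, |q h x| ≤ B := fun x => (q h).norm_coe_le_norm x
  have hB0 : 0 ≤ B := norm_nonneg _
  -- The bound on `t` keeps `q (L + t h) ≥ m / 2`; the `+ 1` covers `B = 0`.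
  have key : ∀ t : ℝ, 0 < t → t < m / (2 * (B + 1)) →
      ∫ x, Ψ x * (q h x / q L x) ∂μ ≤ σ h + t * ((∫ x, Ψ x ∂μ) * (2 * B ^ 2 / m ^ 2)) := by
    intro t ht0 ht
    rw [lt_div_iff₀ (by positivity)] at ht
    have htx : ∀ x, m / 2 ≤ q L x + t * q h x := fun x => by
      have h1 : t * |q h x| ≤ t * B := mul_le_mul_of_nonneg_left (hB x) ht0.le
      have h2 : t * -|q h x| ≤ t * q h x := mul_le_mul_of_nonneg_left (neg_abs_le _) ht0.le
      have := hm x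
      nlinarith
    have hq : ∀ x, q (L + t • h) x = q L x + t * q h x := fun x => by simp
    have hM : L + t • h ∈ posCone q := fun x => by
      rw [hq]; exact lt_of_lt_of_le (by positivity) (htx x)
    have h1 := logBarrier_sub_le (σ := σ) hΨ hΨ0 hL hM
    have h2 : logBarrier μ q Ψ σ L ≤ logBarrier μ q Ψ σ (L + t • h) := hmin hM
    have h3 : ∫ x, Ψ x * (q (t • h) x / q (L + t • h) x) ∂μ
        = t * ∫ x, Ψ x * (q h x / q (L + t • h) x) ∂μ := by
      rw [← integral_const_mul]
      congr 1; ext x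
      simp only [map_smul, ContinuousMap.smul_apply, smul_eq_mul]; ring
    rw [add_sub_cancel_left, h3, map_smul, smul_eq_mul] at h1
    have h4 : ∫ x, Ψ x * (q h x / q (L + t • h) x) ∂μ ≤ σ h := by
      refine le_of_mul_le_mul_left ?_ ht0
      linarith
    have h5 : ∫ x, Ψ x * (q h x / q L x) ∂μ ≤
        ∫ x, (Ψ x * (q h x / q (L + t • h) x) + Ψ x * (t * (2 * B ^ 2 / m ^ 2))) ∂μ := by
      refine integral_mono_ae (integrable_mul_div hΨ hL h)
        ((integrable_mul_div hΨ hM h).add (hΨ.mul_const _)) ?_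
      filter_upwards [hΨ0] with x hx
      rw [← mul_add]
      refine mul_le_mul_of_nonneg_left ?_ hx
      rw [hq]
      have hp : 0 < q L x + t * q h x := lt_of_lt_of_le (by positivity) (htx x)
      have hmm : m ^ 2 / 2 ≤ q L x * (q L x + t * q h x) := by
        calc m ^ 2 / 2 = m * (m / 2) := by ring
          _ ≤ _ := mul_le_mul (hm x) (htx x) (by positivity) (hL x).le
      have hsq : q h x ^ 2 ≤ B ^ 2 := by
        rw [← sq_abs]; exact pow_le_pow_left₀ (abs_nonneg _) (hB x) 2
      have e : q h x / q L x = q h x / (q L x + t * q h x)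
          + t * (q h x ^ 2 / (q L x * (q L x + t * q h x))) := by
        have aux : ∀ s : ℝ, s = q L x + t * q h x → 0 < s →
            q h x / q L x = q h x / s + t * (q h x ^ 2 / (q L x * s)) := by
          intro s hs hs0
          have := (hL x).ne'
          field_simp
          rw [hs]; ring
        exact aux _ rfl hp
      rw [e]
      have : q h x ^ 2 / (q L x * (q L x + t * q h x)) ≤ 2 * B ^ 2 / m ^ 2 := by
        calc q h x ^ 2 / (q L x * (q L x + t * q h x)) ≤ B ^ 2 / (m ^ 2 / 2) :=
              div_le_div₀ (by positivity) hsq (by positivity) hmm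
          _ = _ := by field_simp
      have := mul_le_mul_of_nonneg_left this ht0.le
      linarith
    rw [integral_add (integrable_mul_div hΨ hM h) (hΨ.mul_const _), integral_mul_const] at h5
    linarith
  have hlim : Filter.Tendsto
      (fun t : ℝ => σ h + t * ((∫ x, Ψ x ∂μ) * (2 * B ^ 2 / m ^ 2)))
      (nhdsWithin 0 (Set.Ioi 0)) (nhds (σ h)) := by
    have hc : Continuous (fun t : ℝ => σ h + t * ((∫ x, Ψ x ∂μ) * (2 * B ^ 2 / m ^ 2))) := by
      fun_prop
    have := (hc.tendsto 0).mono_left (nhdsWithin_le_nhds (s := Set.Ioi (0 : ℝ)))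
    simpa using this
  refine ge_of_tendsto hlim ?_
  filter_upwards [Ioo_mem_nhdsGT (show (0 : ℝ) < m / (2 * (B + 1)) by positivity)] with t ht
  exact key t ht.1 ht.2

theorem isStationary_of_isMinOn (hΨ : Integrable Ψ μ) (hΨ0 : ∀ᵐ x ∂μ, 0 ≤ Ψ x) {L : E}
    (hL : L ∈ posCone q) (hmin : IsMinOn (logBarrier μ q Ψ σ) (posCone q) L) :
    IsStationary μ q Ψ σ L := by
  intro h
  refine le_antisymm (integral_le_of_isMinOn hΨ hΨ0 hL hmin h) ?_
  have := integral_le_of_isMinOn hΨ hΨ0 hL hmin (-h)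
  have e : ∫ x, Ψ x * (q (-h) x / q L x) ∂μ = -∫ x, Ψ x * (q h x / q L x) ∂μ := by
    rw [← integral_neg]
    congr 1; ext x
    simp only [map_neg, ContinuousMap.neg_apply]; ring
  rw [e, map_neg] at this
  linarith

variable [IsFiniteMeasure μ]

/-- Through `q` the space embeds injectively into `L²`, and an injective linear map on a
finite-dimensional space is bounded below. -/
theorem exists_mul_sq_norm_le_integral [FiniteDimensional ℝ E] [μ.IsOpenPosMeasure]
    (hq : Function.Injective q) :
    ∃ κ > 0, ∀ h : E, κ * ‖h‖ ^ 2 ≤ ∫ x, q h x ^ 2 ∂μ := by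
  let T : E →ₗ[ℝ] Lp ℝ 2 μ :=
    (ContinuousMap.toLp (E := ℝ) 2 μ ℝ).toLinearMap.comp q.toLinearMap
  have hT : Function.Injective T := (ContinuousMap.toLp_injective μ).comp hq
  obtain ⟨K, hK0, hK⟩ := T.exists_antilipschitzWith (LinearMap.ker_eq_bot.2 hT)
  refine ⟨((K : ℝ) ^ 2)⁻¹, by positivity, fun h => ?_⟩
  have h1 : ‖h‖ ≤ K * ‖T h‖ := by
    have := hK.le_mul_dist h 0
    simpa using this
  have h2 : ‖T h‖ ^ 2 = ∫ x, q h x ^ 2 ∂μ := by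
    rw [← real_inner_self_eq_norm_sq, L2.inner_def]
    refine integral_congr_ae ?_
    filter_upwards [ContinuousMap.coeFn_toLp (p := 2) (𝕜 := ℝ) μ (q h)] with x hx
    change inner ℝ ((ContinuousMap.toLp (E := ℝ) 2 μ ℝ (q h)) x) _ = _
    change inner ℝ ((ContinuousMap.toLp (E := ℝ) 2 μ ℝ (q h)) x)
      ((ContinuousMap.toLp (E := ℝ) 2 μ ℝ (q h)) x) = _
    rw [hx, real_inner_self_eq_norm_sq, Real.norm_eq_abs, sq_abs]
  rw [← h2, inv_mul_le_iff₀ (by positivity), ← mul_pow]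
  exact pow_le_pow_left₀ (norm_nonneg _) h1 2

/-- The basic stability estimate for stationary points. -/
theorem IsStationary.sq_norm_sub_le (hΨ : Integrable Ψ μ) {c : ℝ} (hc : 0 < c)
    (hΨc : ∀ᵐ x ∂μ, c ≤ Ψ x) {κ : ℝ} (hκ : ∀ h : E, κ * ‖h‖ ^ 2 ≤ ∫ x, q h x ^ 2 ∂μ) {L M : E}
    (hL : L ∈ posCone q) (hM : M ∈ posCone q) (hσ : IsStationary μ q Ψ σ L)
    (hτ : IsStationary μ q Ψ τ M) :
    c * (κ * ‖M - L‖ ^ 2) ≤ (‖q‖ * ‖L‖) * (‖q‖ * ‖M‖) * (σ - τ) (M - L) := by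
  set N := (‖q‖ * ‖L‖) * (‖q‖ * ‖M‖)
  have hint := (integrable_mul_div hΨ hL (M - L)).sub (integrable_mul_div hΨ hM (M - L))
  have h1 : (σ - τ) (M - L) =
      ∫ x, (Ψ x * (q (M - L) x / q L x) - Ψ x * (q (M - L) x / q M x)) ∂μ := by
    rw [integral_sub (integrable_mul_div hΨ hL _) (integrable_mul_div hΨ hM _), hσ, hτ]; rfl
  rw [h1, ← integral_const_mul]
  refine (mul_le_mul_of_nonneg_left (hκ (M - L)) hc.le).trans ?_
  rw [← integral_const_mul]
  refine integral_mono_ae ?_ (hint.const_mul N) ?_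
  · exact (((q (M - L)).continuous.pow 2).integrable_of_hasCompactSupport
      (HasCompactSupport.of_compactSpace _)).const_mul c
  filter_upwards [hΨc] with x hx
  have hLx := hL x
  have hMx := hM x
  -- The difference of the stationarity integrands is a nonnegative square over `q L * q M`, and
  -- this denominator is at most `N`.
  have e : Ψ x * (q (M - L) x / q L x) - Ψ x * (q (M - L) x / q M x)
      = Ψ x * (q (M - L) x ^ 2 / (q L x * q M x)) := by
    have : q M x = q (M - L) x + q L x := by simp
    field_simp
    rw [this]; ring
  have hN : q L x * q M x ≤ N := mul_le_mul ((le_abs_self _).trans (apply_le_norm_mul q L x))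
    ((le_abs_self _).trans (apply_le_norm_mul q M x)) hMx.le (by positivity)
  have hN' : 1 ≤ N / (q L x * q M x) := (one_le_div (by positivity)).2 hN
  change c * q (M - L) x ^ 2 ≤
    N * (Ψ x * (q (M - L) x / q L x) - Ψ x * (q (M - L) x / q M x))
  rw [e]
  calc c * q (M - L) x ^ 2 ≤ Ψ x * q (M - L) x ^ 2 * 1 := by
        rw [mul_one]; exact mul_le_mul_of_nonneg_right hx (sq_nonneg _)
    _ ≤ Ψ x * q (M - L) x ^ 2 * (N / (q L x * q M x)) :=
        mul_le_mul_of_nonneg_left hN' (mul_nonneg (hc.le.trans hx) (sq_nonneg _))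
    _ = _ := by ring

/-- Sublevel sets are bounded since `σ` grows linearly and the logarithm slower. A point too close
to the boundary is improved by adding `t p`, so it suffices to minimize over a compact set where `q
L ≥ r`. -/
theorem exists_isMinOn_logBarrier [FiniteDimensional ℝ E] (hΨ : Integrable Ψ μ) {c : ℝ}
    (hc : 0 < c) (hΨc : ∀ᵐ x ∂μ, c ≤ Ψ x) {p : E} (hp : p ∈ posCone q) {δ : ℝ} (hδ : 0 < δ)
    (hσ : ∀ L ∈ posCone q, δ * ‖L‖ ≤ σ L)
    (hdiv : ∀ R M : ℝ, ∃ ε > 0, ∀ L ∈ posCone q, ‖L‖ ≤ R → (∃ x, q L x ≤ ε) →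
      M ≤ ∫ x, (q L x)⁻¹ ∂μ) :
    ∃ L ∈ posCone q, IsMinOn (logBarrier μ q Ψ σ) (posCone q) L := by
  have hΨ0 : ∀ᵐ x ∂μ, 0 ≤ Ψ x := hΨc.mono fun x hx => hc.le.trans hx
  have hI0 : 0 ≤ ∫ x, Ψ x ∂μ := integral_nonneg_of_ae hΨ0
  set I := ∫ x, Ψ x ∂μ with hI
  set J := logBarrier μ q Ψ σ with hJ
  obtain ⟨R, hR⟩ : ∃ R, ∀ L ∈ posCone q, J L ≤ J p → ‖L‖ ≤ R := by
    -- In `log y ≤ y / s - 1 + log s`, this `s` lets the linear term consume at most half of the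
    -- coercivity `δ ‖L‖`.
    set s := 2 * (I * ‖q‖ + 1) / δ with hs
    have hs0 : 0 < s := by positivity
    refine ⟨2 * (J p + I * Real.log s) / δ, fun L hL hLp => ?_⟩
    have h1 : ∫ x, Ψ x * Real.log (q L x) ∂μ ≤ I * (‖q‖ * ‖L‖ / s + Real.log s) := by
      rw [hI, ← integral_mul_const]
      refine integral_mono_ae (integrable_mul_log hΨ hL) (hΨ.mul_const _) ?_
      filter_upwards [hΨ0] with x hx
      refine mul_le_mul_of_nonneg_left ?_ hx
      have h2 := Real.log_le_sub_one_of_pos (div_pos (hL x) hs0)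
      rw [Real.log_div (hL x).ne' hs0.ne'] at h2
      have h3 : q L x / s ≤ ‖q‖ * ‖L‖ / s :=
        div_le_div_of_nonneg_right ((le_abs_self _).trans (apply_le_norm_mul q L x)) hs0.le
      linarith
    have h4 : I * (‖q‖ * ‖L‖ / s) ≤ δ / 2 * ‖L‖ := by
      have : I * (‖q‖ * ‖L‖ / s) = (I * ‖q‖ / s) * ‖L‖ := by ring
      rw [this]
      refine mul_le_mul_of_nonneg_right ?_ (norm_nonneg _)
      rw [div_le_iff₀ hs0, hs]
      field_simp
      linarith
    have h5 : J L = -(∫ x, Ψ x * Real.log (q L x) ∂μ) + σ L := rfl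
    have h6 := hσ L hL
    rw [le_div_iff₀ hδ]
    nlinarith
  obtain ⟨m, hm0, hm⟩ := exists_pos_le_of_continuous (q p).continuous hp
  -- Beyond this threshold the slope along `p`, at most `σ p - c m ∫ 1 / q (L + t p)`, is
  -- nonpositive.
  obtain ⟨ε, hε, hdε⟩ := hdiv (R + ‖p‖) (|σ p| / (c * m))
  -- If `q L x < t`, then `q (L + t p) x ≤ t (1 + ‖q p‖) ≤ ε`, so the divergence hypothesis applies
  -- to the shifted point.
  obtain ⟨t, ht0, ht1, ht⟩ : ∃ t : ℝ, 0 < t ∧ t ≤ 1 ∧ t * (1 + ‖q p‖) ≤ ε := by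
    refine ⟨min 1 (ε / (1 + ‖q p‖)), by positivity, min_le_left _ _, ?_⟩
    rw [← le_div_iff₀ (by positivity)]
    exact min_le_right _ _
  set r := min t (t * m)
  have hr0 : 0 < r := by positivity
  let K : Set E := Metric.closedBall 0 (R + ‖p‖) ∩ {L | ∀ x, r ≤ q L x}
  have hKpos : K ⊆ posCone q := fun L hL x => hr0.trans_le (hL.2 x)
  have hclosed : IsClosed {L : E | ∀ x, r ≤ q L x} := by
    rw [Set.ofPred_forall]
    refine isClosed_iInter fun x => isClosed_le continuous_const ?_
    exact (continuous_eval_const x).comp q.continuous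
  have : ProperSpace E := FiniteDimensional.proper ℝ E
  have hK : IsCompact K := (isCompact_closedBall _ _).inter_right hclosed
  have hcont : ContinuousOn J K := by
    have hC0 : 0 ≤ ‖σ‖ + I * (‖q‖ / r) := by positivity
    have : LipschitzOnWith (Real.toNNReal (‖σ‖ + I * (‖q‖ / r))) J K := by
      refine LipschitzOnWith.of_le_add_mul _ fun M hM L hL => ?_
      rw [Real.coe_toNNReal _ hC0, dist_eq_norm]
      have h1 := logBarrier_sub_le (σ := σ) hΨ hΨ0 (hKpos hL) (hKpos hM)
      have h2 : σ (M - L) ≤ ‖σ‖ * ‖M - L‖ := (le_abs_self _).trans (σ.le_opNorm _)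
      have h3 : -∫ x, Ψ x * (q (M - L) x / q M x) ∂μ ≤ I * (‖q‖ * ‖M - L‖ / r) := by
        rw [hI, ← integral_mul_const, ← integral_neg]
        refine integral_mono_ae (integrable_mul_div hΨ (hKpos hM) _).neg (hΨ.mul_const _) ?_
        filter_upwards [hΨ0] with x hx
        rw [← mul_neg]
        refine mul_le_mul_of_nonneg_left ?_ hx
        rw [← neg_div]
        exact div_le_div₀ (by positivity)
          ((neg_le_abs _).trans (apply_le_norm_mul q (M - L) x)) hr0 (hM.2 x)
      have h4 : I * (‖q‖ * ‖M - L‖ / r) = I * (‖q‖ / r) * ‖M - L‖ := by ring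
      rw [add_mul]
      linarith
    exact this.continuousOn
  have hclaim : ∀ L ∈ posCone q, J L ≤ J p → ∃ M ∈ K, J M ≤ J L := by
    intro L hL hLp
    have hLR := hR L hL hLp
    by_cases hLt : ∀ x, t ≤ q L x
    · refine ⟨L, ⟨?_, fun x => (min_le_left _ _).trans (hLt x)⟩, le_rfl⟩
      rw [mem_closedBall_zero_iff]
      linarith [norm_nonneg p]
    · push Not at hLt
      obtain ⟨x₀, hx₀⟩ := hLt
      have hqM : ∀ x, q (L + t • p) x = q L x + t * q p x := fun x => by simp
      have htm : ∀ x, t * m ≤ q (L + t • p) x := fun x => by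
        rw [hqM]
        have := mul_le_mul_of_nonneg_left (hm x) ht0.le
        linarith [hL x]
      have hM : L + t • p ∈ posCone q := fun x => lt_of_lt_of_le (by positivity) (htm x)
      have hnorm : ‖L + t • p‖ ≤ R + ‖p‖ := by
        refine (norm_add_le _ _).trans (add_le_add hLR ?_)
        rw [norm_smul, Real.norm_of_nonneg ht0.le]
        exact mul_le_of_le_one_left (norm_nonneg _) ht1
      refine ⟨L + t • p, ⟨by rwa [mem_closedBall_zero_iff],
        fun x => (min_le_right _ _).trans (htm x)⟩, ?_⟩
      have h1 := logBarrier_sub_le (σ := σ) hΨ hΨ0 hL hM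
      have h2 := hdε _ hM hnorm ⟨x₀, by
        rw [hqM]
        have : q p x₀ ≤ ‖q p‖ := (le_abs_self _).trans ((q p).norm_coe_le_norm x₀)
        nlinarith⟩
      rw [add_sub_cancel_left] at h1
      have h3 : t * (c * m) * ∫ x, (q (L + t • p) x)⁻¹ ∂μ ≤
          ∫ x, Ψ x * (q (t • p) x / q (L + t • p) x) ∂μ := by
        rw [← integral_const_mul]
        refine integral_mono_ae ?_ (integrable_mul_div hΨ hM _) ?_
        · exact (((q (L + t • p)).continuous.inv₀ fun x =>
            (hM x).ne').integrable_of_hasCompactSupport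
            (HasCompactSupport.of_compactSpace _)).const_mul _
        filter_upwards [hΨc] with x hx
        have hMx := hM x
        have hcm : c * m ≤ Ψ x * q p x := mul_le_mul hx (hm x) hm0.le (hc.le.trans hx)
        have : Ψ x * (q (t • p) x / q (L + t • p) x)
            = t * (Ψ x * q p x) * (q (L + t • p) x)⁻¹ := by
          rw [map_smul, ContinuousMap.smul_apply, smul_eq_mul]; ring
        rw [this]
        gcongr
      have h4 : t * σ p ≤ t * (c * m) * ∫ x, (q (L + t • p) x)⁻¹ ∂μ := by
        rw [div_le_iff₀ (by positivity)] at h2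
        have := mul_le_mul_of_nonneg_left ((le_abs_self _).trans h2) ht0.le
        linarith
      rw [map_smul σ, smul_eq_mul] at h1
      linarith
  obtain ⟨M₀, hM₀, -⟩ := hclaim p hp le_rfl
  obtain ⟨L, hLK, hLmin⟩ := hK.exists_isMinOn ⟨M₀, hM₀⟩ hcont
  refine ⟨L, hKpos hLK, fun N hN => ?_⟩
  have hle : ∀ N ∈ posCone q, J N ≤ J p → J L ≤ J N := fun N hN hNp => by
    obtain ⟨M, hM, hMN⟩ := hclaim N hN hNp
    exact (hLmin hM).trans hMN
  rcases le_total (J N) (J p) with h | h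
  · exact hle N hN h
  · exact (hle p hp le_rfl).trans h

/-- Stationarity fixes `σ L = ∫ Ψ`, so coercivity bounds `‖L‖`. For parameters near `S` the constant
`δ / 2` still works, whence the factor 2 in `R`; the stability estimate then gives a bound linear in
`‖σ T - σ S‖`. -/
theorem continuous_of_isStationary [FiniteDimensional ℝ E] [μ.IsOpenPosMeasure]
    (hq : Function.Injective q) (hΨ : Integrable Ψ μ) {c : ℝ} (hc : 0 < c)
    (hΨc : ∀ᵐ x ∂μ, c ≤ Ψ x) {P : Type*} [TopologicalSpace P] {σ : P → E →L[ℝ] ℝ}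
    (hσ : Continuous σ) {L : P → E} (hL : ∀ S, L S ∈ posCone q)
    (hst : ∀ S, IsStationary μ q Ψ (σ S) (L S))
    (hcoer : ∀ S, ∃ δ > 0, ∀ M ∈ posCone q, δ * ‖M‖ ≤ σ S M) : Continuous L := by
  obtain ⟨κ, hκ0, hκ⟩ := exists_mul_sq_norm_le_integral (μ := μ) hq
  have hI0 : 0 ≤ ∫ x, Ψ x ∂μ := integral_nonneg_of_ae (hΨc.mono fun x hx => hc.le.trans hx)
  rw [continuous_iff_continuousAt]
  intro S
  obtain ⟨δ, hδ0, hδ⟩ := hcoer S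
  set R := 2 * (∫ x, Ψ x ∂μ) / δ with hR
  have hR0 : 0 ≤ R := by positivity
  have hLS : ‖L S‖ ≤ R := by
    have h := hδ _ (hL S)
    rw [(hst S).apply_self (hL S)] at h
    rw [hR, le_div_iff₀ hδ0]
    linarith
  have hσS : Filter.Tendsto (fun T => ‖σ T - σ S‖) (nhds S) (nhds 0) :=
    tendsto_iff_norm_sub_tendsto_zero.1 (hσ.tendsto S)
  have hbound : ∀ᶠ T in nhds S,
      ‖L T - L S‖ ≤ (‖q‖ * R) * (‖q‖ * R) / (c * κ) * ‖σ T - σ S‖ := by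
    filter_upwards [hσS.eventually (gt_mem_nhds (show 0 < δ / 2 by positivity))] with T hT
    have hLT : ‖L T‖ ≤ R := by
      have h1 := hδ _ (hL T)
      have h2 : -(σ T - σ S) (L T) ≤ δ / 2 * ‖L T‖ :=
        (neg_le_abs _).trans (((σ T - σ S).le_opNorm _).trans
          (mul_le_mul_of_nonneg_right hT.le (norm_nonneg _)))
      rw [_root_.sub_apply, (hst T).apply_self (hL T)] at h2
      rw [hR, le_div_iff₀ hδ0]
      linarith
    have h := IsStationary.sq_norm_sub_le hΨ hc hΨc hκ (hL S) (hL T) (hst S) (hst T)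
    have h3 : (σ S - σ T) (L T - L S) ≤ ‖σ T - σ S‖ * ‖L T - L S‖ := by
      rw [← norm_sub_rev (σ S)]
      exact (le_abs_self _).trans ((σ S - σ T).le_opNorm _)
    have h4 : c * (κ * ‖L T - L S‖ ^ 2) ≤
        (‖q‖ * R) * (‖q‖ * R) * (‖σ T - σ S‖ * ‖L T - L S‖) := by
      refine h.trans ((mul_le_mul_of_nonneg_left h3 (by positivity)).trans ?_)
      gcongr
    rcases (norm_nonneg (L T - L S)).eq_or_lt with h0 | h0
    · rw [← h0]; positivity
    · rw [div_mul_eq_mul_div, le_div_iff₀ (by positivity)]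
      refine le_of_mul_le_mul_right ?_ h0
      linarith
  rw [ContinuousAt, tendsto_iff_norm_sub_tendsto_zero]
  refine squeeze_zero' (Filter.Eventually.of_forall fun _ => norm_nonneg _) hbound ?_
  simpa using hσS.const_mul ((‖q‖ * R) * (‖q‖ * R) / (c * κ))

end LogBarrier

end

/-! ### Spectral densities, and the barrier analysis applied to the range of `Γ`. -/

section

variable {n : ℕ} {A : Matrix (Fin n) (Fin n) ℂ} {b : Fin n → ℂ} {Ψ Φ : Circle → ℝ}

theorem IsSpectralDensity.integrable (hΦ : IsSpectralDensity Φ) : Integrable Φ circleMeasure := by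
  obtain ⟨hm, c, C, hc, h⟩ := hΦ
  refine Integrable.of_bound hm C (h.mono fun z hz => ?_)
  rw [Real.norm_of_nonneg (hc.le.trans hz.1)]
  exact hz.2

theorem IsSpectralDensity.integrable_mul_log (hΨ : IsSpectralDensity Ψ)
    (hΦ : IsSpectralDensity Φ) :
    Integrable (fun z => Ψ z * Real.log (Φ z)) circleMeasure := by
  obtain ⟨hm, c, C, hc, h⟩ := hΦ
  refine hΨ.integrable.mul_bdd (c := max |Real.log c| |Real.log C|)
    (Real.measurable_log.comp_aemeasurable hm.aemeasurable).aestronglyMeasurable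
    (h.mono fun z hz => ?_)
  rw [Real.norm_eq_abs]
  exact abs_le_max_abs_abs (Real.log_le_log hc hz.1)
    (Real.log_le_log (hc.trans_le hz.1) hz.2)

theorem IsSpectralDensity.div_continuous (hΨ : IsSpectralDensity Ψ) {f : Circle → ℝ}
    (hf : Continuous f) (h0 : ∀ z, 0 < f z) : IsSpectralDensity fun z => Ψ z / f z := by
  obtain ⟨hm, c, C, hc, h⟩ := hΨ
  obtain ⟨m, hm0, hmf⟩ := exists_pos_le_of_continuous hf h0
  obtain ⟨N, hN⟩ := isCompact_univ.exists_bound_of_continuousOn hf.continuousOn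
  have hN0 : 0 < N := (h0 1).trans_le ((le_abs_self _).trans (hN 1 trivial))
  refine ⟨?_, c / N, C / m, by positivity, h.mono fun z hz => ⟨?_, ?_⟩⟩
  · exact (hm.aemeasurable.div hf.measurable.aemeasurable).aestronglyMeasurable
  · exact div_le_div₀ (hc.le.trans hz.1) hz.1 (h0 z) ((le_abs_self _).trans (hN z trivial))
  · exact div_le_div₀ (hc.le.trans (hz.1.trans hz.2)) hz.2 hm0 (hmf z)

/-- By homogeneity only the compact unit sphere matters, where the form of `S` has a positive
minimum. -/
theorem exists_pos_posDef_sub {S M : Matrix (Fin n) (Fin n) ℂ} (hS : S.PosDef)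
    (hM : M.IsHermitian) : ∃ ε : ℝ, 0 < ε ∧ (S - ε • M).PosDef := by
  have hsph : IsCompact (Metric.sphere (0 : Fin n → ℂ) 1) := isCompact_sphere _ _
  have hcS : ∀ N : Matrix (Fin n) (Fin n) ℂ,
      Continuous fun x : Fin n → ℂ => (star x ⬝ᵥ (N *ᵥ x)).re := fun N => by
    simp only [dotProduct, mulVec]
    fun_prop
  obtain ⟨C, hC⟩ := hsph.exists_bound_of_continuousOn (hcS M).continuousOn
  have hpos : ∀ x : Fin n → ℂ, x ≠ 0 → 0 < (star x ⬝ᵥ (S *ᵥ x)).re := fun x hx =>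
    (Complex.pos_iff.1 (hS.dotProduct_mulVec_pos hx)).1
  obtain ⟨m, hm0, hm⟩ : ∃ m > 0, ∀ x ∈ Metric.sphere (0 : Fin n → ℂ) 1,
      m ≤ (star x ⬝ᵥ (S *ᵥ x)).re := by
    rcases (Metric.sphere (0 : Fin n → ℂ) 1).eq_empty_or_nonempty with he | hne
    · exact ⟨1, one_pos, by simp [he]⟩
    · obtain ⟨x, hx, hmin⟩ := hsph.exists_isMinOn hne (hcS S).continuousOn
      exact ⟨_, hpos x (by rintro rfl; simp at hx), fun y hy => hmin hy⟩
  refine ⟨m / (2 * (|C| + 1)), by positivity, ?_⟩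
  set ε := m / (2 * (|C| + 1)) with hε
  have hε0 : 0 < ε := by positivity
  have hεC : ε * |C| < m := by
    rw [hε, div_mul_eq_mul_div, div_lt_iff₀ (by positivity)]
    nlinarith [abs_nonneg C]
  have hherm : (S - ε • M).IsHermitian := hS.1.sub (by
    rw [IsHermitian, conjTranspose_smul, hM.eq, star_trivial])
  refine PosDef.of_dotProduct_mulVec_pos hherm fun x hx => ?_
  have him : (star x ⬝ᵥ ((S - ε • M) *ᵥ x)).im = 0 := hherm.im_star_dotProduct_mulVec_self x
  rw [Complex.pos_iff]
  refine ⟨?_, him.symm⟩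
  set y : Fin n → ℂ := ((‖x‖⁻¹ : ℝ) : ℂ) • x with hy
  have hx0 : 0 < ‖x‖ := norm_pos_iff.2 hx
  have hysph : y ∈ Metric.sphere (0 : Fin n → ℂ) 1 := by
    rw [mem_sphere_zero_iff_norm, hy, norm_smul, Complex.norm_real, norm_inv, norm_norm,
      inv_mul_cancel₀ hx0.ne']
  have hxy : x = ((‖x‖ : ℝ) : ℂ) • y := by
    rw [hy, smul_smul, ← Complex.ofReal_mul, mul_inv_cancel₀ hx0.ne', Complex.ofReal_one, one_smul]
  have hyv : 0 < (star y ⬝ᵥ ((S - ε • M) *ᵥ y)).re := by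
    rw [sub_mulVec, smul_mulVec, dotProduct_sub, dotProduct_smul, Complex.sub_re, Complex.smul_re,
      smul_eq_mul]
    have h1 := hm y hysph
    have h2 := (le_abs_self _).trans ((hC y hysph).trans (le_abs_self C))
    have h3 := mul_le_mul_of_nonneg_left h2 hε0.le
    linarith
  have e : star x ⬝ᵥ ((S - ε • M) *ᵥ x)
      = ((‖x‖ * ‖x‖ : ℝ) : ℂ) * (star y ⬝ᵥ ((S - ε • M) *ᵥ y)) := by
    conv_lhs => rw [hxy]
    rw [mulVec_smul, star_smul, smul_dotProduct, dotProduct_smul, smul_smul, smul_eq_mul]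
    push_cast
    simp
  rw [e, Complex.re_ofReal_mul]
  positivity

/-- The range of `Γ` as a normed space, with the largest modulus of an entry as the norm. -/
def RangeSpace (hA : IsStabilityMatrix A) (b : Fin n → ℂ) : Type := rangeSub hA b

namespace RangeSpace

instance (hA : IsStabilityMatrix A) : NormedAddCommGroup (RangeSpace hA b) :=
  letI : NormedAddCommGroup (Matrix (Fin n) (Fin n) ℂ) := Matrix.normedAddCommGroup
  letI : NormedSpace ℝ (Matrix (Fin n) (Fin n) ℂ) := Matrix.normedSpace
  Submodule.normedAddCommGroup (rangeSub hA b)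

instance (hA : IsStabilityMatrix A) : NormedSpace ℝ (RangeSpace hA b) :=
  letI : NormedAddCommGroup (Matrix (Fin n) (Fin n) ℂ) := Matrix.normedAddCommGroup
  letI : NormedSpace ℝ (Matrix (Fin n) (Fin n) ℂ) := Matrix.normedSpace
  Submodule.normedSpace (rangeSub hA b)

/-- An element of the range of `Γ`, as a point of `RangeSpace`. -/
def mk (hA : IsStabilityMatrix A) (L : Matrix (Fin n) (Fin n) ℂ) (hL : L ∈ rangeGamma A b) :
    RangeSpace hA b :=
  (⟨L, hL⟩ : rangeSub hA b)

variable {hA : IsStabilityMatrix A}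

/-- The matrix given by a point of `RangeSpace`. -/
def toMatrix : RangeSpace hA b →ₗ[ℝ] Matrix (Fin n) (Fin n) ℂ := (rangeSub hA b).subtype

@[simp]
theorem toMatrix_mk (L : Matrix (Fin n) (Fin n) ℂ) (hL : L ∈ rangeGamma A b) :
    toMatrix (mk hA L hL) = L := rfl

theorem toMatrix_mem (L : RangeSpace hA b) : toMatrix L ∈ rangeGamma A b :=
  Subtype.prop (p := (· ∈ rangeSub hA b)) L

theorem toMatrix_injective :
    Function.Injective (toMatrix : RangeSpace hA b →ₗ[ℝ] Matrix (Fin n) (Fin n) ℂ) :=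
  Subtype.val_injective

instance : FiniteDimensional ℝ (RangeSpace hA b) :=
  FiniteDimensional.of_injective toMatrix toMatrix_injective

theorem norm_toMatrix_apply_le (L : RangeSpace hA b) (i j : Fin n) : ‖toMatrix L i j‖ ≤ ‖L‖ :=
  letI : NormedAddCommGroup (Matrix (Fin n) (Fin n) ℂ) := Matrix.normedAddCommGroup
  Matrix.norm_entry_le_entrywise_sup_norm (toMatrix L)

end RangeSpace

open RangeSpace

/-- The map `L ↦ G* L G` on the range of `Γ`. -/
def rangeQuad (hA : IsStabilityMatrix A) (b : Fin n → ℂ) :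
    RangeSpace hA b →L[ℝ] C(Circle, ℝ) :=
  LinearMap.toContinuousLinearMap ((quadMap hA b).comp toMatrix)

@[simp]
theorem rangeQuad_apply (hA : IsStabilityMatrix A) (L : RangeSpace hA b) (z : Circle) :
    rangeQuad hA b L z = quadForm A b (toMatrix L) z := rfl

theorem rangeQuad_injective (hA : IsStabilityMatrix A) :
    Function.Injective (rangeQuad hA b) := by
  rw [injective_iff_map_eq_zero]
  intro L hL
  refine toMatrix_injective ?_
  rw [map_zero]
  exact hA.eq_zero_of_quadForm (toMatrix_mem L) fun z => DFunLike.congr_fun hL z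

/-- The pairing `S ↦ (L ↦ tr (L S))`, for `L` in the range of `Γ`. -/
def tracePairing (hA : IsStabilityMatrix A) (b : Fin n → ℂ) :
    Matrix (Fin n) (Fin n) ℂ →ₗ[ℝ] (RangeSpace hA b →L[ℝ] ℝ) :=
  LinearMap.toContinuousLinearMap.toLinearMap.comp
    (LinearMap.mk₂ ℝ (fun S (L : RangeSpace hA b) => (toMatrix L * S).trace.re)
      (by intros; simp [mul_add]) (by intros; simp)
      (by intros; simp [add_mul]) (by intros; simp))

@[simp]
theorem tracePairing_apply (hA : IsStabilityMatrix A) (S : Matrix (Fin n) (Fin n) ℂ)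
    (L : RangeSpace hA b) :
    tracePairing hA b S L = (toMatrix L * S).trace.re := rfl

theorem continuous_tracePairing (hA : IsStabilityMatrix A) :
    Continuous (tracePairing hA b) :=
  LinearMap.continuous_of_finiteDimensional _

/-- The projection of the identity onto the range has quadratic form `G* G`, which never vanishes.
-/
theorem posCone_rangeQuad_nonempty (hA : IsStabilityMatrix A) (hb : b ≠ 0) :
    (posCone (rangeQuad hA b)).Nonempty := by
  obtain ⟨L, hL, hLq, -⟩ := hA.exists_mem_quadForm_eq (b := b) 1
  refine ⟨mk hA L hL, fun z => ?_⟩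
  rw [rangeQuad_apply, toMatrix_mk, hLq]
  exact (Complex.pos_iff.1 (PosDef.one.dotProduct_mulVec_pos (hA.G_ne_zero hb z))).1

/-- Nonnegativity of the trace against `S - ε ∫ G G*` gives `tr (L S) ≥ ε ∫ q L`. As `0 ≤ q L ≤ Q
‖L‖`, also `κ ‖L‖² ≤ ∫ (q L)² ≤ Q ‖L‖ ∫ q L`. -/
theorem tracePairing_coercive (hA : IsStabilityMatrix A) {S : Matrix (Fin n) (Fin n) ℂ}
    (hS : S ∈ PGamma A b) :
    ∃ δ > 0, ∀ L ∈ posCone (rangeQuad hA b), δ * ‖L‖ ≤ tracePairing hA b S L := by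
  obtain ⟨κ, hκ0, hκ⟩ :=
    exists_mul_sq_norm_le_integral (μ := circleMeasure) (rangeQuad_injective (b := b) hA)
  obtain ⟨ε, hε0, hε⟩ := exists_pos_posDef_sub hS.2
    (stateCov_isHermitian (A := A) (b := b) (1 : C(Circle, ℝ)))
  have hmem : S - ε • stateCov A b (1 : C(Circle, ℝ)) ∈ PGamma A b :=
    ⟨(rangeSub hA b).sub_mem hS.1 ((rangeSub hA b).smul_mem ε ⟨1, rfl⟩), hε⟩
  set Q := ‖rangeQuad hA b‖
  refine ⟨ε * κ / (Q + 1), by positivity, fun L hL => ?_⟩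
  have h1 := hA.trace_mul_re_nonneg hmem (L := toMatrix L) fun z => (hL z).le
  have hint : ∫ z, ((1 : C(Circle, ℝ)) : Circle → ℝ) z * quadForm A b (toMatrix L) z ∂circleMeasure
      = ∫ z, rangeQuad hA b L z ∂circleMeasure := by simp
  rw [mul_sub, trace_sub, Complex.sub_re, mul_smul_comm, trace_smul, Complex.smul_re,
    hA.trace_mul_stateCov_re (integrable_coe _), hint, smul_eq_mul] at h1
  rw [tracePairing_apply]
  have h2 : κ * ‖L‖ ^ 2 ≤ Q * ‖L‖ * ∫ z, rangeQuad hA b L z ∂circleMeasure := by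
    refine (hκ L).trans ?_
    rw [← integral_const_mul]
    refine integral_mono (integrable_coe ((rangeQuad hA b L) ^ 2))
      ((integrable_coe (rangeQuad hA b L)).const_mul _) fun z => ?_
    simp only
    rw [pow_two]
    exact mul_le_mul_of_nonneg_right ((le_abs_self _).trans (apply_le_norm_mul _ L z)) (hL z).le
  have hI0 : 0 ≤ ∫ z, rangeQuad hA b L z ∂circleMeasure := integral_nonneg fun z => (hL z).le
  have h3 : κ * ‖L‖ ≤ (Q + 1) * ∫ z, rangeQuad hA b L z ∂circleMeasure := by
    rcases (norm_nonneg L).eq_or_lt with h0 | h0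
    · rw [← h0, mul_zero]; positivity
    · refine le_of_mul_le_mul_right ?_ h0
      nlinarith
  have h4 := mul_le_mul_of_nonneg_left h3 hε0.le
  rw [div_mul_eq_mul_div, div_le_iff₀ (by positivity)]
  have h5 : ε * ∫ z, rangeQuad hA b L z ∂circleMeasure ≤ (toMatrix L * S).trace.re := by linarith
  have h6 := mul_le_mul_of_nonneg_right h5 (show 0 ≤ Q + 1 by positivity)
  linarith

theorem rangeQuad_integral_inv_diverges (hA : IsStabilityMatrix A) (R M : ℝ) :
    ∃ ε > 0, ∀ L ∈ posCone (rangeQuad hA b), ‖L‖ ≤ R → (∃ z, rangeQuad hA b L z ≤ ε) →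
      M ≤ ∫ z, (rangeQuad hA b L z)⁻¹ ∂circleMeasure := by
  obtain ⟨K, hK0, hK⟩ := hA.exists_lipschitz_quadForm (b := b)
  have hKR : 0 < K * |R| + 1 := by positivity
  -- The slope `K |R| + 1` dominates the Lipschitz constant of every form with `‖L‖ ≤ R` and is
  -- positive even if `K |R| = 0`.
  obtain ⟨ε, hε0, hε⟩ := exists_le_integral_inv hKR M
  refine ⟨ε, hε0, fun L hL hLR ⟨w, hw⟩ => (hε ε hε0 le_rfl w).trans ?_⟩
  have hlip : ∀ z, rangeQuad hA b L z ≤ ε + (K * |R| + 1) * dist z w := fun z => by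
    have h := hK (toMatrix L) |R| (fun i j => (norm_toMatrix_apply_le L i j).trans
      (hLR.trans (le_abs_self R))) z w
    have h' := (le_abs_self _).trans h
    rw [rangeQuad_apply] at hw ⊢
    have : 0 ≤ dist z w := dist_nonneg
    linarith
  refine integral_mono ?_ ?_ fun z => inv_anti₀ (hL z) (hlip z)
  · have hcont : Continuous fun z : Circle => (ε + (K * |R| + 1) * dist z w)⁻¹ :=
      Continuous.inv₀ (by fun_prop) fun z => by positivity
    exact integrable_coe ⟨_, hcont⟩
  · exact integrable_coe ⟨_, (rangeQuad hA b L).continuous.inv₀ fun z => (hL z).ne'⟩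

theorem isDualSolution_iff (hA : IsStabilityMatrix A) {S L : Matrix (Fin n) (Fin n) ℂ} :
    IsDualSolution A b Ψ S L ↔ ∃ hL : L ∈ rangeGamma A b,
      mk hA L hL ∈ posCone (rangeQuad hA b) ∧
      IsMinOn (logBarrier circleMeasure (rangeQuad hA b) Ψ (tracePairing hA b S))
        (posCone (rangeQuad hA b)) (mk hA L hL) := by
  constructor
  · rintro ⟨⟨-, hpos, hL⟩, hmin⟩
    exact ⟨hL, hpos, fun M hM =>
      hmin (a := toMatrix M)
        ⟨isHermitian_of_mem_rangeGamma (toMatrix_mem M), hM, toMatrix_mem M⟩⟩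
  · rintro ⟨hL, hpos, hmin⟩
    exact ⟨⟨isHermitian_of_mem_rangeGamma hL, hpos, hL⟩,
      fun M hM => hmin (a := mk hA M hM.2.2) hM.2.1⟩

theorem IsSpectralDensity.exists_le (hΨ : IsSpectralDensity Ψ) :
    ∃ c > 0, ∀ᵐ z ∂circleMeasure, c ≤ Ψ z := by
  obtain ⟨-, c, C, hc, h⟩ := hΨ
  exact ⟨c, hc, h.mono fun z hz => hz.1⟩

theorem existsUnique_isDualSolution (hA : IsStabilityMatrix A) (hb : b ≠ 0)
    (hΨ : IsSpectralDensity Ψ) {S : Matrix (Fin n) (Fin n) ℂ} (hS : S ∈ PGamma A b) :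
    ∃! L, IsDualSolution A b Ψ S L := by
  obtain ⟨c, hc, hΨc⟩ := hΨ.exists_le
  have hΨ0 : ∀ᵐ z ∂circleMeasure, 0 ≤ Ψ z := hΨc.mono fun z hz => hc.le.trans hz
  obtain ⟨p, hp⟩ := posCone_rangeQuad_nonempty hA hb
  obtain ⟨δ, hδ0, hδ⟩ := tracePairing_coercive hA hS
  obtain ⟨L, hL, hmin⟩ := exists_isMinOn_logBarrier hΨ.integrable hc hΨc hp hδ0 hδ
    (rangeQuad_integral_inv_diverges hA)
  refine ⟨toMatrix L, (isDualSolution_iff hA).2 ⟨toMatrix_mem L, hL, hmin⟩, fun M hM => ?_⟩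
  obtain ⟨hMr, hMpos, hMmin⟩ := (isDualSolution_iff hA).1 hM
  obtain ⟨κ, hκ0, hκ⟩ :=
    exists_mul_sq_norm_le_integral (μ := circleMeasure) (rangeQuad_injective (b := b) hA)
  have h := IsStationary.sq_norm_sub_le hΨ.integrable hc hΨc hκ hL hMpos
    (isStationary_of_isMinOn hΨ.integrable hΨ0 hL hmin)
    (isStationary_of_isMinOn hΨ.integrable hΨ0 hMpos hMmin)
  rw [sub_self, _root_.zero_apply, mul_zero] at h
  have h0 : ‖mk hA M hMr - L‖ = 0 := by
    by_contra hne
    have : 0 < ‖mk hA M hMr - L‖ ^ 2 := by positivity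
    have : 0 < c * (κ * ‖mk hA M hMr - L‖ ^ 2) := by positivity
    linarith
  exact congrArg toMatrix (sub_eq_zero.1 (norm_eq_zero.1 h0))

theorem isDualSolution_dualOpt (hA : IsStabilityMatrix A) (hb : b ≠ 0)
    (hΨ : IsSpectralDensity Ψ) {S : Matrix (Fin n) (Fin n) ℂ} (hS : S ∈ PGamma A b) :
    IsDualSolution A b Ψ S (dualOpt A b Ψ S) :=
  Classical.epsilon_spec (existsUnique_isDualSolution hA hb hΨ hS).exists

theorem IsDualSolution.isStationary (hA : IsStabilityMatrix A) (hΨ : IsSpectralDensity Ψ)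
    {S L : Matrix (Fin n) (Fin n) ℂ} (hL : IsDualSolution A b Ψ S L) :
    IsStationary circleMeasure (rangeQuad hA b) Ψ (tracePairing hA b S)
      (mk hA L hL.1.2.2) := by
  obtain ⟨c, hc, hΨc⟩ := hΨ.exists_le
  obtain ⟨hLr, hpos, hmin⟩ := (isDualSolution_iff hA).1 hL
  exact isStationary_of_isMinOn hΨ.integrable (hΨc.mono fun z hz => hc.le.trans hz) hpos hmin

theorem IsDualSolution.stateCov_eq (hA : IsStabilityMatrix A) (hΨ : IsSpectralDensity Ψ)
    {S L : Matrix (Fin n) (Fin n) ℂ} (hS : S ∈ rangeGamma A b) (hL : IsDualSolution A b Ψ S L) :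
    stateCov A b (fun z => Ψ z / quadForm A b L z) = S := by
  have hΦ := hΨ.div_continuous (hA.continuous_quadForm L) hL.1.2.1
  set Φ := fun z => Ψ z / quadForm A b L z with hΦdef
  have hherm : (stateCov A b Φ - S).IsHermitian :=
    (stateCov_isHermitian Φ).sub (isHermitian_of_mem_rangeGamma hS)
  rw [← sub_eq_zero]
  refine IsHermitian.eq_zero_of_trace_mul_self hherm ?_
  -- Stationarity tests only directions in the range, and `Φ` need not be continuous; so the defect
  -- is replaced by its projection `M`, which has the same form and the same trace against `S`.
  obtain ⟨M, hM, hMq, hMtr⟩ := hA.exists_mem_quadForm_eq (b := b) (stateCov A b Φ - S)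
  rw [mul_sub, trace_sub, Complex.sub_re, hA.trace_mul_stateCov_re hΦ.integrable, ← hMtr S hS]
  have h := hL.isStationary hA hΨ (mk hA M hM)
  rw [tracePairing_apply, toMatrix_mk] at h
  rw [← h, sub_eq_zero]
  refine integral_congr_ae (Filter.Eventually.of_forall fun z => ?_)
  simp only [rangeQuad_apply, toMatrix_mk, hMq, hΦdef]
  ring

/-- With `u = Φ f / Ψ`, the gap between the distances is `∫ Ψ (u - 1 - log u)`, because equal
covariances force `∫ Φ f = ∫ Ψ`. The integrand is nonnegative and vanishes only where `u = 1`. -/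
theorem klDist_le_imp_ae_eq (hA : IsStabilityMatrix A) (hΨ : IsSpectralDensity Ψ)
    (hΦ : IsSpectralDensity Φ) {L : Matrix (Fin n) (Fin n) ℂ} (hL : ∀ z, 0 < quadForm A b L z)
    (hcov : stateCov A b (fun z => Ψ z / quadForm A b L z) = stateCov A b Φ) :
    klDist Ψ (fun z => Ψ z / quadForm A b L z) ≤ klDist Ψ Φ ∧
      (klDist Ψ Φ ≤ klDist Ψ (fun z => Ψ z / quadForm A b L z) →
        Φ =ᵐ[circleMeasure] fun z => Ψ z / quadForm A b L z) := by
  set f := quadForm A b L with hf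
  have hfc : Continuous f := hA.continuous_quadForm L
  have hΦ' := hΨ.div_continuous hfc hL
  obtain ⟨c, hc, hΨc⟩ := hΨ.exists_le
  obtain ⟨d, hd, hΦd⟩ := hΦ.exists_le
  have hint1 := hΨ.integrable_mul_log hΨ
  have hint2 := hΨ.integrable_mul_log hΦ
  have hint3 : Integrable (fun z => Ψ z * Real.log (f z)) circleMeasure :=
    integrable_mul_continuous hΨ.integrable (hfc.log fun z => (hL z).ne')
  have hint4 : Integrable (fun z => Φ z * f z) circleMeasure :=
    integrable_mul_continuous hΦ.integrable hfc
  have hmass : ∫ z, Φ z * f z ∂circleMeasure = ∫ z, Ψ z ∂circleMeasure := by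
    rw [← hA.trace_mul_stateCov_re hΦ.integrable, ← hcov, hA.trace_mul_stateCov_re hΦ'.integrable]
    refine integral_congr_ae (Filter.Eventually.of_forall fun z => ?_)
    exact div_mul_cancel₀ _ (hL z).ne'
  have hk1 : klDist Ψ (fun z => Ψ z / f z) = ∫ z, Ψ z * Real.log (f z) ∂circleMeasure := by
    refine integral_congr_ae (hΨc.mono fun z hz => ?_)
    simp only
    rw [div_div_cancel₀ (hc.trans_le hz).ne']
  have hk2 : klDist Ψ Φ = (∫ z, Ψ z * Real.log (Ψ z) ∂circleMeasure)
      - ∫ z, Ψ z * Real.log (Φ z) ∂circleMeasure := by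
    rw [← integral_sub hint1 hint2]
    refine integral_congr_ae ?_
    filter_upwards [hΨc, hΦd] with z hz hz'
    rw [Real.log_div (hc.trans_le hz).ne' (hd.trans_le hz').ne', mul_sub]
  let w : Circle → ℝ := fun z => Ψ z * Real.log (Ψ z) - Ψ z * Real.log (Φ z)
    - Ψ z * Real.log (f z) - Ψ z + Φ z * f z
  have hwint : Integrable w circleMeasure :=
    (((hint1.sub hint2).sub hint3).sub hΨ.integrable).add hint4
  have hwI : ∫ z, w z ∂circleMeasure = klDist Ψ Φ - klDist Ψ (fun z => Ψ z / f z) := by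
    have e1 := integral_add (((hint1.sub hint2).sub hint3).sub hΨ.integrable) hint4
    have e2 := integral_sub ((hint1.sub hint2).sub hint3) hΨ.integrable
    have e3 := integral_sub (hint1.sub hint2) hint3
    have e4 := integral_sub hint1 hint2
    simp only [Pi.sub_apply] at e1 e2 e3 e4
    rw [e1, e2, e3, e4, hmass, hk1, hk2]
    ring
  have hweq : ∀ᵐ z ∂circleMeasure, 0 < Ψ z ∧ 0 < Φ z * f z / Ψ z ∧
      w z = Ψ z * (Φ z * f z / Ψ z - 1 - Real.log (Φ z * f z / Ψ z)) := by
    filter_upwards [hΨc, hΦd] with z hz hz'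
    have h1 := hc.trans_le hz
    have h2 := hd.trans_le hz'
    have h3 := hL z
    refine ⟨h1, by positivity, ?_⟩
    rw [Real.log_div (by positivity) h1.ne', Real.log_mul h2.ne' h3.ne']
    simp only [w]
    field_simp
    ring
  have hw0 : 0 ≤ᵐ[circleMeasure] w := by
    filter_upwards [hweq] with z hz
    rw [hz.2.2]
    exact mul_nonneg hz.1.le (by linarith [Real.log_le_sub_one_of_pos hz.2.1])
  refine ⟨by linarith [integral_nonneg_of_ae hw0], fun hle => ?_⟩
  have hzero : ∫ z, w z ∂circleMeasure = 0 :=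
    le_antisymm (by linarith) (integral_nonneg_of_ae hw0)
  filter_upwards [(integral_eq_zero_iff_of_nonneg_ae hw0 hwint).1 hzero, hweq] with z hz1 hz2
  obtain ⟨hp, hu, hwz⟩ := hz2
  rw [hwz] at hz1
  have h1 : Φ z * f z / Ψ z = 1 := by
    by_contra hne
    have := Real.log_lt_sub_one_of_pos hu hne
    rcases mul_eq_zero.1 hz1 with h | h
    · exact hp.ne' h
    · linarith
  rw [div_eq_one_iff_eq hp.ne'] at h1
  rw [← h1, mul_div_cancel_right₀ _ (hL z).ne']

theorem isPrimalSolution_optSpectrum (hA : IsStabilityMatrix A) (hb : b ≠ 0)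
    (hΨ : IsSpectralDensity Ψ) {S : Matrix (Fin n) (Fin n) ℂ} (hS : S ∈ PGamma A b) :
    IsPrimalSolution A b Ψ S (optSpectrum A b Ψ S) ∧
      ∀ Φ : Circle → ℝ, IsPrimalSolution A b Ψ S Φ →
        Φ =ᵐ[circleMeasure] optSpectrum A b Ψ S := by
  have hL := isDualSolution_dualOpt hA hb hΨ hS
  have hcov := hL.stateCov_eq hA hΨ hS.1
  have hd : IsSpectralDensity (optSpectrum A b Ψ S) :=
    hΨ.div_continuous (hA.continuous_quadForm _) hL.1.2.1
  refine ⟨⟨hd, hcov, fun Φ hΦ hΦS => ?_⟩, fun Φ hΦ => ?_⟩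
  · exact (klDist_le_imp_ae_eq hA hΨ hΦ hL.1.2.1 (hcov.trans hΦS.symm)).1
  · exact (klDist_le_imp_ae_eq hA hΨ hΦ.1 hL.1.2.1 (hcov.trans hΦ.2.1.symm)).2
      (hΦ.2.2 _ hd hcov)

theorem IsSpectralDensity.memLp_top (hΦ : IsSpectralDensity Φ) : MemLp Φ ∞ circleMeasure := by
  obtain ⟨hm, c, C, hc, h⟩ := hΦ
  refine memLp_top_of_bound hm C (h.mono fun z hz => ?_)
  rw [Real.norm_of_nonneg (hc.le.trans hz.1)]
  exact hz.2

/-! ### Continuity of the optimal spectrum in `L_∞`. -/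

/-- The minimum point of the dual functional, as a point of the range of `Γ`. -/
def dualPoint (hA : IsStabilityMatrix A) (hb : b ≠ 0) (hΨ : IsSpectralDensity Ψ)
    (S : PGamma A b) : RangeSpace hA b :=
  mk hA (dualOpt A b Ψ S) (isDualSolution_dualOpt hA hb hΨ S.2).1.2.2

theorem continuous_dualPoint (hA : IsStabilityMatrix A) (hb : b ≠ 0)
    (hΨ : IsSpectralDensity Ψ) : Continuous (dualPoint hA hb hΨ) := by
  obtain ⟨c, hc, hΨc⟩ := hΨ.exists_le
  exact continuous_of_isStationary (rangeQuad_injective hA) hΨ.integrable hc hΨc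
    (σ := fun S : PGamma A b => tracePairing hA b S)
    ((continuous_tracePairing hA).comp continuous_subtype_val)
    (fun S => (isDualSolution_dualOpt hA hb hΨ S.2).1.2.1)
    (fun S => (isDualSolution_dualOpt hA hb hΨ S.2).isStationary hA hΨ)
    (fun S => tracePairing_coercive hA S.2)

/-- The denominators `F T` tend to `F S` uniformly and are eventually at least `m / 2`, so the
quotients, with the same bounded numerator `Ψ`, converge in `L_∞`; no continuity of `Ψ` is involved.
-/
theorem continuous_toLp_optSpectrum (hA : IsStabilityMatrix A) (hb : b ≠ 0)
    (hΨ : IsSpectralDensity Ψ)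
    (h : ∀ S : PGamma A b, MemLp (optSpectrum A b Ψ S) ∞ circleMeasure) :
    Continuous fun S : PGamma A b =>
      ((h S).toLp (optSpectrum A b Ψ S) : Lp ℝ ∞ circleMeasure) := by
  obtain ⟨c, C, hc, hC⟩ := hΨ.2
  set F : PGamma A b → C(Circle, ℝ) := fun S => rangeQuad hA b (dualPoint hA hb hΨ S) with hF
  have hFc : Continuous F := (rangeQuad hA b).continuous.comp (continuous_dualPoint hA hb hΨ)
  have hFpos : ∀ S z, 0 < F S z := fun S => (isDualSolution_dualOpt hA hb hΨ S.2).1.2.1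
  have hopt : ∀ S : PGamma A b, ∀ z, optSpectrum A b Ψ S z = Ψ z / F S z := fun S z => rfl
  rw [continuous_iff_continuousAt]
  intro S
  obtain ⟨m, hm0, hm⟩ := exists_pos_le_of_continuous (F S).continuous (hFpos S)
  have hFS : Filter.Tendsto (fun T => ‖F T - F S‖) (nhds S) (nhds 0) :=
    tendsto_iff_norm_sub_tendsto_zero.1 (hFc.tendsto S)
  rw [ContinuousAt, tendsto_iff_norm_sub_tendsto_zero]
  refine squeeze_zero' (g := fun T => |C| / (m / 2 * m) * ‖F T - F S‖)
    (Filter.Eventually.of_forall fun _ => norm_nonneg _) ?_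
    (by simpa using hFS.const_mul (|C| / (m / 2 * m)))
  filter_upwards [hFS.eventually (gt_mem_nhds (show 0 < m / 2 by positivity))] with T hT
  rw [← MemLp.toLp_sub]
  have hbd : ∀ᵐ z ∂circleMeasure,
      ‖((h T).sub (h S)).toLp (optSpectrum A b Ψ T - optSpectrum A b Ψ S) z‖
        ≤ |C| / (m / 2 * m) * ‖F T - F S‖ := by
    filter_upwards [hC, ((h T).sub (h S)).coeFn_toLp] with z hz hz'
    have hd : |F T z - F S z| ≤ ‖F T - F S‖ := (F T - F S).norm_coe_le_norm z
    have hT2 : m / 2 ≤ F T z := by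
      have := (neg_le_abs _).trans hd
      linarith [hm z]
    have hTz := hFpos T z
    have hSz := hFpos S z
    rw [hz', Pi.sub_apply, hopt, hopt, Real.norm_eq_abs]
    have e : Ψ z / F T z - Ψ z / F S z = Ψ z / (F T z * F S z) * -(F T z - F S z) := by
      field_simp
      ring
    have hΨz : 0 ≤ Ψ z := hc.le.trans hz.1
    rw [e, abs_mul, abs_neg, abs_of_nonneg (by positivity)]
    refine mul_le_mul ?_ hd (abs_nonneg _) (by positivity)
    exact div_le_div₀ (abs_nonneg C) (hz.2.trans (le_abs_self C)) (by positivity)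
      (mul_le_mul hT2 (hm z) hm0.le hTz.le)
  have := Lp.norm_le_of_ae_bound (by positivity) hbd
  simpa using this

end

end SpectrumApprox

end

theorem mainTheorem3 (n : ℕ) (A : Matrix (Fin n) (Fin n) ℂ) (b : Fin n → ℂ)
    (hA : SpectrumApprox.IsStabilityMatrix A) (hb : b ≠ 0)
    (hAb : SpectrumApprox.IsReachable A b)
    (Ψ : Circle → ℝ) (hΨ : SpectrumApprox.IsSpectralDensity Ψ) :
    (∀ S ∈ SpectrumApprox.PGamma A b,
      ∃! L : Matrix (Fin n) (Fin n) ℂ, SpectrumApprox.IsDualSolution A b Ψ S L) ∧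
    (∀ S ∈ SpectrumApprox.PGamma A b,
      SpectrumApprox.IsPrimalSolution A b Ψ S (SpectrumApprox.optSpectrum A b Ψ S) ∧
      ∀ Φ : Circle → ℝ, SpectrumApprox.IsPrimalSolution A b Ψ S Φ →
        Φ =ᵐ[SpectrumApprox.circleMeasure] SpectrumApprox.optSpectrum A b Ψ S) ∧
    ∃ h : ∀ S : SpectrumApprox.PGamma A b,
        MemLp (SpectrumApprox.optSpectrum A b Ψ S) ∞ SpectrumApprox.circleMeasure,
      Continuous fun S : SpectrumApprox.PGamma A b =>
        ((h S).toLp (SpectrumApprox.optSpectrum A b Ψ S) :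
          Lp ℝ ∞ SpectrumApprox.circleMeasure) := by
  refine ⟨fun S hS => SpectrumApprox.existsUnique_isDualSolution hA hb hΨ hS,
    fun S hS => SpectrumApprox.isPrimalSolution_optSpectrum hA hb hΨ hS,
    fun S => (SpectrumApprox.isPrimalSolution_optSpectrum hA hb hΨ S.2).1.1.memLp_top, ?_⟩
  exact SpectrumApprox.continuous_toLp_optSpectrum hA hb hΨ _
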